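/- **Setting.** Let $p\ge 1$, let $\Sigma\in\mathbb R^{p\times p}$ be positive definite, $\Sigma_W\in\mathbb R^{p\times p}$ positive semidefinite, $\sigma\ge 0$, and let $\bar\theta\in\mathbb R^p$ be $s^*$-sparse. Write $\kappa(\Sigma)=\sigma_{\max}(\Sigma)/\sigma_{\min}(\Sigma)$ and $\|\cdot\|$ for the spectral norm of a matrix. Let $X_1,\dots,X_n\in\mathbb R^p$ be i.i.d. with covariance $\Sigma$ and centred sub-Gaussian with a constant $K$, i.e. $\mathbb E\,e^{t\langle u,X_i\rangle}\le e^{K^2\|\Sigma\|t^2/2}$ for all unit vectors $u$ and all $t\in\mathbb R$; let $W_i\sim\mathcal N(0,\Sigma_W)$ and $\xi_i\sim\mathcal N(0,\sigma^2)$, all independent. One observes $\tilde X_i=X_i+W_i$ (additive feature noise) and $Y_i=\langle\bar\theta,X_i\rangle+\xi_i$. Put $$\hat\Gamma=\tfrac1n\tilde X^T\tilde X-\Sigma_W,\qquad \hat\gamma=\tfrac1n\tilde X^TY,\qquad \mathcal L(\theta)=\tfrac12\theta^T\hat\Gamma\theta-\hat\gamma^T\theta$$ (a loss that may be non-convex).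 Let $s=\lceil1568\,\kappa(\Sigma)^2s^*\rceil$, $k=2s+s^*$ and, for a constant $c_0>0$ and a number $v$, $$\tau(p)=c_0\,\sigma_{\min}(\Sigma)\max\Big(\frac{v^2}{\sigma_{\min}(\Sigma)^2},1\Big)\log p,\qquad L=\tfrac32\sigma_{\max}(\Sigma)+\frac{k\,\tau(p)}n .$$ Iterative hard thresholding (IHT) starts at $\theta^1=0$ and sets $\theta^{t+1}=P_s\big(\theta^t-\tfrac{2}{3L}\nabla\mathcal L(\theta^t)\big)$, where $P_s$ keeps $s$ entries of largest magnitude (ties broken arbitrarily; all entries if $s\ge p$) and zeroes the rest. For constants $c_0,\dots,c_4>0$ and numbers $v,\rho\ge 0$, say that the *guarantee holds with scale $v$ and noise level $\rho$* if, whenever $n\ge 4k\,\tau(p)/\sigma_{\min}(\Sigma)$, the following holds with probability at least $1-c_1p^{-c_2}$: a minimizer $\theta^*$ of $\mathcal L$ over the $s^*$-sparse vectors exists and, for every run of IHT, 1. for all $\tau\ge 1$ and all $\epsilon\ge 0$ with $\mathcal L(\theta^\tau)-\mathcal L(\theta^*)\le\epsilon$, $$\|\bar\theta-\theta^\tau\|_2\le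 c_3\,\frac{\kappa(\Sigma)}{\sigma_{\min}(\Sigma)}\,\rho\,\sqrt{\frac{s^*\log p}{n}}+2\sqrt{\frac{\epsilon}{\sigma_{\min}(\Sigma)}}\,;$$ 2. for all $\epsilon>0$ and all integers $\tau\ge1$ with $\tau\ge 1+c_4\,\kappa(\Sigma)\log\frac{\mathcal L(\theta^1)-\mathcal L(\theta^*)}{\epsilon}$ (the logarithm read as $0$ if $\theta^1$ is already a minimizer), $\mathcal L(\theta^\tau)-\mathcal L(\theta^*)\le\epsilon$. **Theorem.** Let $K\ge 0$. (a) There are constants $c_0,\dots,c_4>0$ depending only on $K$ such that, for all data as above, the guarantee holds with $$v=\|\Sigma\|+\|\Sigma_W\|,\qquad \rho=\sqrt{\|\Sigma_W\|+\|\Sigma\|}\,\big(\sqrt{\|\Sigma_W\|}\,\|\bar\theta\|_2+\sigma\big).$$ (b) For every $m>0$ there are constants $c_0,\dots,c_4>0$ depending only on $K$ and $m$ such that, for all data as above that also satisfy $\|\Sigma\|+\|\Sigma_W\|\ge m$, $\|\Sigma_W\|+\sigma\ge m$ and $\|\bar\theta\|_2\ge m$, the guarantee holds with $$v=\|\Sigma\|^2+\|\Sigma_W\|^2,\qquad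 \rho=\tilde\sigma\,\|\bar\theta\|_2,\qquad \tilde\sigma=\sqrt{\|\Sigma_W\|^2+\|\Sigma\|^2}\,\big(\|\Sigma_W\|+\sigma\big).$$ -/

import Mathlib

open MeasureTheory ProbabilityTheory
open scoped NNReal

namespace NoisyIHT

/-- Euclidean space `ℝᵖ`. -/
abbrev Vec (p : ℕ) := EuclideanSpace ℝ (Fin p)

/-- The number `‖v‖₀` of nonzero coordinates. -/
noncomputable def l0 {p : ℕ} (v : Vec p) : ℕ := hammingNorm (WithLp.ofLp v)

/-- Spectral (operator) norm of a square matrix. -/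
noncomputable def opNorm {p : ℕ} (A : Matrix (Fin p) (Fin p) ℝ) : ℝ≥0 :=
  ‖Matrix.toEuclideanCLM (n := Fin p) (𝕜 := ℝ) A‖₊

/-- Largest singular value (singular values are listed in decreasing order, starting at `0`). -/
noncomputable def sigmaMax {p : ℕ} (A : Matrix (Fin p) (Fin p) ℝ) : ℝ :=
  (Matrix.toEuclideanLin A).singularValues 0

/-- Smallest singular value. -/
noncomputable def sigmaMin {p : ℕ} (A : Matrix (Fin p) (Fin p) ℝ) : ℝ :=
  (Matrix.toEuclideanLin A).singularValues (p - 1)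

/-- Condition number `κ(A) = σ_max(A) / σ_min(A)`. -/
noncomputable def kappa {p : ℕ} (A : Matrix (Fin p) (Fin p) ℝ) : ℝ :=
  sigmaMax A / sigmaMin A

/-! ### The statistical model -/

/-- Linear regression with additive Gaussian feature noise. The clean covariates `X i` are i.i.d.
with covariance `Sig` and (centred) sub-Gaussian: every unit direction has sub-Gaussian variance
proxy at most `K² ‖Sig‖`, that is `𝔼 exp (t ⟨u, X i⟩) ≤ exp (K² ‖Sig‖ t² / 2)`. The feature noise
`W i` is `N(0, SigW)`, the label noise `ξ i` is `N(0, σ²)`, and everything is independent. -/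
structure IsAdditiveNoiseModel {Ω : Type*} [MeasurableSpace Ω] (μ : Measure Ω) {n p : ℕ}
    (K : ℝ≥0) (Sig SigW : Matrix (Fin p) (Fin p) ℝ) (σ : ℝ≥0)
    (X W : Fin n → Ω → Vec p) (ξ : Fin n → Ω → ℝ) : Prop where
  measurable_X : ∀ i, Measurable (X i)
  measurable_W : ∀ i, Measurable (W i)
  measurable_ξ : ∀ i, Measurable (ξ i)
  identDistrib_X : ∀ i j, IdentDistrib (X i) (X j) μ μ
  subgaussian_X : ∀ i, ∀ u : Vec p, ‖u‖ = 1 →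
    HasSubgaussianMGF (fun ω => inner ℝ u (X i ω)) (K ^ 2 * opNorm Sig) μ
  covariance_X : ∀ i j k, cov[fun ω => X i ω j, fun ω => X i ω k; μ] = Sig j k
  law_W : ∀ i, HasLaw (W i) (multivariateGaussian 0 SigW) μ
  law_ξ : ∀ i, HasLaw (ξ i) (gaussianReal 0 (σ ^ 2)) μ
  indep_samples : iIndepFun (fun i ω => (X i ω, W i ω, ξ i ω)) μ
  indep_X_W : ∀ i, IndepFun (X i) (W i) μ
  indep_XW_ξ : ∀ i, IndepFun (fun ω => (X i ω, W i ω)) (ξ i) μ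

/-- `Γ̂ = X̃ᵀ X̃ / n - SigW`, for the `n × p` matrix `X̃` of corrupted covariates. -/
noncomputable def GammaHat {n p : ℕ} (SigW : Matrix (Fin p) (Fin p) ℝ)
    (Xt : Matrix (Fin n) (Fin p) ℝ) : Matrix (Fin p) (Fin p) ℝ :=
  (n : ℝ)⁻¹ • (Xt.transpose * Xt) - SigW

/-- `γ̂ = X̃ᵀ Y / n`. -/
noncomputable def gammaHat {n p : ℕ} (Xt : Matrix (Fin n) (Fin p) ℝ) (Y : Fin n → ℝ) :
    Fin p → ℝ :=
  (n : ℝ)⁻¹ • Xt.transpose.mulVec Y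

/-- The corrected quadratic loss `½ θᵀ Γ̂ θ - γ̂ᵀ θ`. -/
noncomputable def correctedLoss {n p : ℕ} (SigW : Matrix (Fin p) (Fin p) ℝ)
    (Xt : Matrix (Fin n) (Fin p) ℝ) (Y : Fin n → ℝ) (θ : Vec p) : ℝ :=
  (1 / 2) * (WithLp.ofLp θ ⬝ᵥ (GammaHat SigW Xt).mulVec (WithLp.ofLp θ))
    - gammaHat Xt Y ⬝ᵥ WithLp.ofLp θ

/-- The loss at the outcome `ω`: the observed covariates are `X i + W i`, the observed labels are
`⟨θbar, X i⟩ + ξ i`. -/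
noncomputable def sampleLoss {Ω : Type*} {n p : ℕ} (SigW : Matrix (Fin p) (Fin p) ℝ)
    (θbar : Vec p) (X W : Fin n → Ω → Vec p) (ξ : Fin n → Ω → ℝ) (ω : Ω) : Vec p → ℝ :=
  correctedLoss SigW (Matrix.of fun i j => X i ω j + W i ω j)
    (fun i => inner ℝ θbar (X i ω) + ξ i ω)

/-! ### Iterative hard thresholding -/

/-- `θ` is obtained from `z` by keeping `s` entries of largest magnitude (all of them if `s ≥ p`)
and zeroing the others. Ties may be broken in any way. -/
def IsHardThreshold {p : ℕ} (s : ℕ) (z θ : Vec p) : Prop :=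
  ∃ S : Finset (Fin p), S.card = min s p ∧ (∀ i ∈ S, ∀ j ∉ S, |z j| ≤ |z i|) ∧
    ∀ j, θ j = if j ∈ S then z j else 0

/-- `θ 1, θ 2, …` are the iterates of hard-thresholded gradient descent on `f` with sparsity level
`s` and step size `η`, started at `θ 1 = 0`. -/
def IsIHTRun {p : ℕ} (f : Vec p → ℝ) (s : ℕ) (η : ℝ) (θ : ℕ → Vec p) : Prop :=
  θ 1 = 0 ∧ ∀ t, 1 ≤ t → IsHardThreshold s (θ t - η • gradient f (θ t)) (θ (t + 1))

/-- `θopt` minimizes `f` over the `s`-sparse vectors. -/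
def IsSparseMinimizer {p : ℕ} (f : Vec p → ℝ) (s : ℕ) (θopt : Vec p) : Prop :=
  l0 θopt ≤ s ∧ ∀ θ : Vec p, l0 θ ≤ s → f θopt ≤ f θ

/-- The sparsity level `s = 1568 κ² s*` of the iterates, rounded up to an integer. -/
noncomputable def iterSparsity {p : ℕ} (Sig : Matrix (Fin p) (Fin p) ℝ) (sStar : ℕ) : ℕ :=
  ⌈1568 * kappa Sig ^ 2 * (sStar : ℝ)⌉₊

/-- The level `k = 2 s + s*` at which restricted convexity and smoothness are used. -/
noncomputable def rscLevel {p : ℕ} (Sig : Matrix (Fin p) (Fin p) ℝ) (sStar : ℕ) : ℕ :=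
  2 * iterSparsity Sig sStar + sStar

/-- `τ(p) = c₀ σ_min max (v² / σ_min², 1) log p`, where `v` measures the size of the covariance of
the corrupted covariates. -/
noncomputable def tol {p : ℕ} (c₀ v : ℝ) (Sig : Matrix (Fin p) (Fin p) ℝ) : ℝ :=
  c₀ * sigmaMin Sig * max (v ^ 2 / sigmaMin Sig ^ 2) 1 * Real.log p

/-- The restricted smoothness parameter `L = 1.5 σ_max + k τ(p) / n`. -/
noncomputable def smoothness {p : ℕ} (c₀ v : ℝ) (Sig : Matrix (Fin p) (Fin p) ℝ)
    (sStar n : ℕ) : ℝ :=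
  3 / 2 * sigmaMax Sig + rscLevel Sig sStar * tol c₀ v Sig / n

/-- The step size `η = 2 / (3 L)`. -/
noncomputable def stepSize {p : ℕ} (c₀ v : ℝ) (Sig : Matrix (Fin p) (Fin p) ℝ)
    (sStar n : ℕ) : ℝ :=
  2 / (3 * smoothness c₀ v Sig sStar n)

/-- What is claimed, at one outcome, about hard-thresholded gradient descent on the loss `f`.
A minimizer `θopt` over the `s*`-sparse vectors exists, and every run satisfies:
* whenever the `τ`-th iterate has function value error at most `ε`, it is within
  `statErr + 2 √(ε / σ_min)` of `θbar`;
* the function value error is at most `ε > 0` as soon as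
  `τ ≥ 1 + c κ log ((f (θ¹) - f (θopt)) / ε)`. -/
def IHTGuarantee {p : ℕ} (Sig : Matrix (Fin p) (Fin p) ℝ) (sStar : ℕ) (θbar : Vec p)
    (f : Vec p → ℝ) (η statErr c : ℝ) : Prop :=
  ∃ θopt : Vec p, IsSparseMinimizer f sStar θopt ∧
    ∀ θ : ℕ → Vec p, IsIHTRun f (iterSparsity Sig sStar) η θ →
      (∀ τ : ℕ, 1 ≤ τ → ∀ ε : ℝ, 0 ≤ ε → f (θ τ) - f θopt ≤ ε →
        ‖θbar - θ τ‖ ≤ statErr + 2 * √(ε / sigmaMin Sig)) ∧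
      (∀ ε : ℝ, 0 < ε → ∀ τ : ℕ, 1 ≤ τ →
        1 + c * kappa Sig * Real.log ((f (θ 1) - f θopt) / ε) ≤ τ →
        f (θ τ) - f θopt ≤ ε)

end NoisyIHT

/-! The loss is a quadratic with exact expansion `f (θ + d) = f θ + ⟨∇f θ, d⟩ + Q d / 2`, where `Q`
is the form of `Γ̂`. Two events, failing with probability at most `2 / p` each, suffice: `|Q d - dᵀ
Σ d| ≤ (σ_min / 2) ‖d‖²` for all `k`-sparse `d`, and every entry of the gradient at `θbar` is of
order `√(log p / n)` times the noise level.

Deterministic half. On the first event the loss is strongly convex and smooth along sparse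
directions, even if `Γ̂` is indefinite. Hard thresholding to `s` entries is nearly a convex
projection when compared with much sparser vectors (`IsHardThreshold.two_mul_inner_le`), so each
step contracts the function value error by `1 - O(1/κ)` (`hardThreshold_step_contraction`).
Expanding at `θbar` and pairing the small gradient with a sparse difference turns function value
error into distance (`norm_sub_le_of_sub_le`). These combine in `ihtGuarantee_of_restricted`.

Probabilistic half. Both `Γ̂ - Σ` and the gradient at `θbar` are centred averages of products of
sub-Gaussian variables; subtracting `Σ_W` removes the bias in both. Such products have exponential
moments, so a Bernstein bound applies (`measure_lt_abs_average_mul_sub_le`). Union bounds over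
half-nets of coordinate subspaces and over coordinates give uniformity.
`measure_not_ihtGuarantee_le` joins the halves; part (b) follows by comparing scales through `m`. -/

namespace NoisyIHT

section Deterministic

variable {p : ℕ}

/-! ### Sparse vectors and hard thresholding -/

lemma l0_eq_card (v : Vec p) : l0 v = (Finset.univ.filter fun i => v i ≠ 0).card := rfl

lemma l0_le_card {v : Vec p} {S : Finset (Fin p)} (h : ∀ j ∉ S, v j = 0) : l0 v ≤ S.card := by
  rw [l0_eq_card]
  refine Finset.card_le_card fun i hi => ?_
  by_contra hc
  exact (Finset.mem_filter.1 hi).2 (h i hc)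

lemma l0_sub_le (a b : Vec p) : l0 (a - b) ≤ l0 a + l0 b := by
  rw [l0_eq_card a, l0_eq_card b]
  refine (l0_le_card ?_).trans (Finset.card_union_le _ _)
  intro j hj
  simp only [Finset.mem_union, Finset.mem_filter, Finset.mem_univ, true_and, not_or,
    not_not] at hj
  simp [hj.1, hj.2]

lemma l0_zero : l0 (0 : Vec p) = 0 := by simp [l0_eq_card]

lemma l0_le_dim (v : Vec p) : l0 v ≤ p := by
  simpa using l0_le_card (v := v) (S := Finset.univ) (by simp)

lemma norm_sq_eq_sum (v : Vec p) : ‖v‖ ^ 2 = ∑ i, v i ^ 2 := EuclideanSpace.real_norm_sq_eq v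

lemma inner_eq_sum (u v : Vec p) : inner ℝ u v = ∑ i, u i * v i := by
  simp [PiLp.inner_apply, mul_comm]

lemma inner_eq_dotProduct (u v : Vec p) :
    inner ℝ u v = WithLp.ofLp u ⬝ᵥ WithLp.ofLp v := inner_eq_sum u v

/-- Relative concavity of hard thresholding: if `x` keeps the entries of `z` in `S`, the largest
ones, then no sparse vector `y` makes a very acute angle with the residual. -/
lemma two_mul_inner_le_of_largest {S U : Finset (Fin p)} {x y z : Vec p} {c : ℝ}
    (hx : ∀ j, x j = if j ∈ S then z j else 0)
    (hS : ∀ i ∈ S, ∀ j ∉ S, |z j| ≤ |z i|) (hy : ∀ j ∉ U, y j = 0) (hc : 0 < c)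
    (hcard : ((U \ S).card : ℝ) ≤ c ^ 2 * (S \ U).card) :
    2 * inner ℝ (y - x) (z - x) ≤ c * ‖y - x‖ ^ 2 := by
  -- `z - x` vanishes on `S`, and off `S` only `y` contributes to `y - x`.
  have h1 : inner ℝ (y - x) (z - x) = ∑ j ∈ U \ S, y j * z j := by
    rw [inner_eq_sum]
    symm
    refine (Finset.sum_subset_zero_on_sdiff (Finset.subset_univ _) ?_ ?_)
    · intro j hj
      simp only [Finset.mem_sdiff, Finset.mem_univ, true_and, not_and, not_not] at hj
      by_cases hjS : j ∈ S
      · simp [hx, hjS]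
      · have hjU : j ∉ U := fun h => hjS (hj h)
        simp [hx, hjS, hy j hjU]
    · intro j hj
      simp [hx, (Finset.mem_sdiff.1 hj).2]
  have h2 : ∑ j ∈ U \ S, y j ^ 2 + ∑ j ∈ S \ U, z j ^ 2 ≤ ‖y - x‖ ^ 2 := by
    have hd : Disjoint (U \ S) (S \ U) := disjoint_sdiff_sdiff
    have e1 : ∑ j ∈ U \ S, y j ^ 2 = ∑ j ∈ U \ S, (y - x) j ^ 2 :=
      Finset.sum_congr rfl fun j hj => by simp [hx, (Finset.mem_sdiff.1 hj).2]
    have e2 : ∑ j ∈ S \ U, z j ^ 2 = ∑ j ∈ S \ U, (y - x) j ^ 2 :=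
      Finset.sum_congr rfl fun j hj => by
        simp [hx, (Finset.mem_sdiff.1 hj).1, hy j (Finset.mem_sdiff.1 hj).2]
    rw [e1, e2, ← Finset.sum_union hd, norm_sq_eq_sum]
    exact Finset.sum_le_sum_of_subset_of_nonneg (Finset.subset_univ _) fun _ _ _ => sq_nonneg _
  rcases (U \ S).eq_empty_or_nonempty with he | hne
  · rw [h1, he]; simp; positivity
  obtain ⟨j0, hj0, hmax⟩ := Finset.exists_max_image (U \ S) (fun j => |z j|) hne
  set m := |z j0|
  -- Weighted AM-GM, then the discarded mass, at most `|U \ S| m²`, is charged to the kept entries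
  -- on `S \ U`, each of size at least `m`.
  have h3 : 2 * ∑ j ∈ U \ S, y j * z j ≤ c * ∑ j ∈ U \ S, y j ^ 2 + c * ((S \ U).card * m ^ 2) := by
    have : ∀ j ∈ U \ S, 2 * (y j * z j) ≤ c * y j ^ 2 + c⁻¹ * m ^ 2 := by
      intro j hj
      have hz : z j ^ 2 ≤ m ^ 2 := sq_le_sq' (by linarith [neg_abs_le (z j), hmax j hj])
        ((le_abs_self _).trans (hmax j hj))
      have h4 : 2 * (y j * z j) ≤ c * y j ^ 2 + c⁻¹ * z j ^ 2 := by
        have := mul_nonneg (inv_nonneg.2 hc.le) (sq_nonneg (c * y j - z j))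
        have e : c⁻¹ * (c * y j - z j) ^ 2 = c * y j ^ 2 + c⁻¹ * z j ^ 2 - 2 * (y j * z j) := by
          field_simp; ring
        linarith
      have := mul_le_mul_of_nonneg_left hz (inv_nonneg.2 hc.le)
      linarith
    rw [Finset.mul_sum]
    refine (Finset.sum_le_sum this).trans ?_
    rw [Finset.sum_add_distrib, ← Finset.mul_sum, Finset.sum_const, nsmul_eq_mul]
    have : ((U \ S).card : ℝ) * (c⁻¹ * m ^ 2) ≤ c ^ 2 * (S \ U).card * (c⁻¹ * m ^ 2) :=
      mul_le_mul_of_nonneg_right hcard (by positivity)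
    have e : c ^ 2 * (S \ U).card * (c⁻¹ * m ^ 2) = c * ((S \ U).card * m ^ 2) := by
      field_simp
    linarith
  have h5 : (S \ U).card * m ^ 2 ≤ ∑ j ∈ S \ U, z j ^ 2 := by
    rw [← nsmul_eq_mul, ← Finset.sum_const]
    refine Finset.sum_le_sum fun i hi => ?_
    rw [← sq_abs (z i)]
    exact pow_le_pow_left₀ (abs_nonneg _)
      (hS i (Finset.mem_sdiff.1 hi).1 j0 (Finset.mem_sdiff.1 hj0).2) 2
  rw [h1]
  calc _ ≤ c * (∑ j ∈ U \ S, y j ^ 2 + ∑ j ∈ S \ U, z j ^ 2) := by nlinarith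
    _ ≤ _ := mul_le_mul_of_nonneg_left h2 hc.le

lemma IsHardThreshold.l0_le {s : ℕ} {z x : Vec p} (h : IsHardThreshold s z x) : l0 x ≤ s := by
  obtain ⟨S, hS, -, hx⟩ := h
  refine (l0_le_card (S := S) fun j hj => by simp [hx, hj]).trans ?_
  omega

/-- Comparison of the hard threshold with a much sparser vector. -/
lemma IsHardThreshold.two_mul_inner_le {s t : ℕ} {x y z : Vec p} {c : ℝ}
    (h : IsHardThreshold s z x) (hy : l0 y ≤ t) (hc : 0 < c)
    (hst : (t : ℝ) ≤ c ^ 2 * (s - t)) :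
    2 * inner ℝ (y - x) (z - x) ≤ c * ‖y - x‖ ^ 2 := by
  obtain ⟨S, hS, hS2, hx⟩ := h
  set U := Finset.univ.filter fun i => y i ≠ 0
  have hU : U.card ≤ t := hy
  refine two_mul_inner_le_of_largest hx hS2 (U := U) (by simp [U]) hc ?_
  rcases (U \ S).eq_empty_or_nonempty with he | ⟨j, hj⟩
  · rw [he]; simp; positivity
  -- A coordinate outside `S` rules out `s > p`, so exactly `s` entries were kept.
  have hlt : S.card < p := by
    simpa using Finset.card_lt_univ_of_notMem (Finset.mem_sdiff.1 hj).2
  have hSs : S.card = s := by omega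
  have h1 : s ≤ (S \ U).card + t := by
    have := Finset.le_card_sdiff U S
    omega
  have h2 : ((s : ℝ) - t) ≤ (S \ U).card := by
    have : (s : ℝ) ≤ (S \ U).card + t := by exact_mod_cast h1
    linarith
  have h3 : ((U \ S).card : ℝ) ≤ t := by
    exact_mod_cast (Finset.card_le_card Finset.sdiff_subset).trans hU
  exact h3.trans (hst.trans (mul_le_mul_of_nonneg_left h2 (by positivity)))

/-- Hard thresholding is a projection onto the sparse vectors. -/
lemma IsHardThreshold.two_mul_inner_le_self {s : ℕ} {x y z : Vec p}
    (h : IsHardThreshold s z x) (hy : l0 y ≤ s) :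
    2 * inner ℝ (y - x) (z - x) ≤ ‖y - x‖ ^ 2 := by
  obtain ⟨S, hS, hS2, hx⟩ := h
  set U := Finset.univ.filter fun i => y i ≠ 0
  have hU : U.card ≤ S.card := by
    have h1 : U.card ≤ s := hy
    have h2 : U.card ≤ p := l0_le_dim y
    omega
  have := two_mul_inner_le_of_largest hx hS2 (U := U) (y := y) (by simp [U]) one_pos ?_
  · simpa using this
  · have h1 := Finset.card_sdiff_add_card_inter U S
    have h2 := Finset.card_sdiff_add_card_inter S U
    rw [Finset.inter_comm] at h2
    have : (U \ S).card ≤ (S \ U).card := by omega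
    simpa using this

/-! ### Convergence of iterative hard thresholding on a restricted quadratic -/

/-- One step of hard-thresholded gradient descent contracts the function value error. -/
lemma hardThreshold_step_contraction {f Q : Vec p → ℝ}
    (hexp : ∀ θ d, f (θ + d) = f θ + inner ℝ (gradient f θ) d + 1 / 2 * Q d)
    {s t : ℕ} {α L η c : ℝ} (hη : 0 < η) (hηL : η * L ≤ 2 / 3) (hc : 0 < c)
    (hcα : c < η * α) (hα1 : η * α ≤ 1) (hst : (t : ℝ) ≤ c ^ 2 * (s - t))
    (hlo : ∀ d, l0 d ≤ 2 * s + t → α * ‖d‖ ^ 2 ≤ Q d)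
    (hup : ∀ d, l0 d ≤ 2 * s + t → Q d ≤ L * ‖d‖ ^ 2)
    {θ x y : Vec p} (hθ : l0 θ ≤ s) (hy : l0 y ≤ t)
    (hx : IsHardThreshold s (θ - η • gradient f θ) x) :
    f x - f y ≤ (1 - (η * α - c) / 3) * (f θ - f y) := by
  set g := gradient f θ
  have hA := hx.two_mul_inner_le_self hθ
  have hB := hx.two_mul_inner_le hy hc hst
  have hfx : f x ≤ f θ + inner ℝ g (x - θ) + 1 / 2 * (L * ‖x - θ‖ ^ 2) := by
    have h1 := hexp θ (x - θ)
    rw [add_sub_cancel] at h1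
    have h2 := hup (x - θ) ((l0_sub_le _ _).trans (by have := hx.l0_le; omega))
    linarith
  have hfy : f θ + inner ℝ g (y - θ) + 1 / 2 * (α * ‖y - θ‖ ^ 2) ≤ f y := by
    have h1 := hexp θ (y - θ)
    rw [add_sub_cancel] at h1
    have h2 := hlo (y - θ) ((l0_sub_le _ _).trans (by omega))
    linarith
  set d := x - θ with hd
  set u := y - θ with hu
  have e1 : θ - x = -d := by simp [hd]
  have e2 : θ - η • g - x = -d - η • g := by rw [hd]; abel
  have e3 : y - x = u - d := by rw [hd, hu]; abel
  rw [e1, e2] at hA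
  rw [e3, e2] at hB
  have hA' : 2 * η * inner ℝ g d ≤ -‖d‖ ^ 2 := by
    rw [inner_sub_right, inner_neg_left, inner_neg_left, inner_neg_right, norm_neg,
      inner_smul_right, real_inner_self_eq_norm_sq, real_inner_comm] at hA
    linarith
  have hB' : 2 * η * (inner ℝ g d - inner ℝ g u) ≤
      ‖u‖ ^ 2 - ‖d‖ ^ 2 - (1 - c) * ‖u - d‖ ^ 2 := by
    have h1 : ‖u - d‖ ^ 2 = ‖u‖ ^ 2 - 2 * inner ℝ u d + ‖d‖ ^ 2 := norm_sub_sq_real u d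
    have h2 : inner ℝ (u - d) (-d - η • g) =
        -inner ℝ u d + ‖d‖ ^ 2 - η * (inner ℝ g u - inner ℝ g d) := by
      simp only [inner_sub_left, inner_sub_right, inner_neg_right, inner_smul_right,
        real_inner_self_eq_norm_sq, real_inner_comm]
      ring
    rw [h2] at hB
    linarith
  set δ := η * α - c with hδ
  have hδ0 : 0 < δ := by linarith
  have hδ1 : δ ≤ 1 := by linarith
  -- The difference of the two sides is `‖δ u - d‖²`.
  have hCauchy : δ * (1 - δ) * ‖u‖ ^ 2 - (1 - δ) * ‖d‖ ^ 2 ≤ δ * ‖u - d‖ ^ 2 := by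
    have h1 : ‖u - d‖ ^ 2 = ‖u‖ ^ 2 - 2 * inner ℝ u d + ‖d‖ ^ 2 := norm_sub_sq_real u d
    have h2 : ‖δ • u - d‖ ^ 2 = δ ^ 2 * ‖u‖ ^ 2 - 2 * (δ * inner ℝ u d) + ‖d‖ ^ 2 := by
      rw [norm_sub_sq_real, norm_smul, inner_smul_left, mul_pow]
      simp
    have h3 := sq_nonneg ‖δ • u - d‖
    rw [h2] at h3
    rw [h1]
    linarith
  -- Convex combination of the comparisons with the old iterate and with `y`. Since `η L ≤ 2/3`, a
  -- third of `‖d‖²` is left over; weight `δ / 3` spends at most that third, and the coefficient of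
  -- `‖u‖²` comes out as `-c δ² / 3`.
  have hmix : 2 * η * (inner ℝ g d - δ / 3 * inner ℝ g u) ≤
      -‖d‖ ^ 2 + δ / 3 * (‖u‖ ^ 2 - (1 - c) * ‖u - d‖ ^ 2) := by
    linarith [mul_le_mul_of_nonneg_left hA' (by linarith : (0 : ℝ) ≤ 1 - δ / 3),
      mul_le_mul_of_nonneg_left hB' (by linarith : (0 : ℝ) ≤ δ / 3)]
  have hfin : 2 * η * (f x - f y - (1 - δ / 3) * (f θ - f y)) ≤ 0 := by
    have h1 : 2 * η * f x ≤ 2 * η * (f θ + inner ℝ g d) + η * L * ‖d‖ ^ 2 := by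
      linarith [mul_le_mul_of_nonneg_left hfx hη.le]
    have h2 : 2 * η * (f θ + inner ℝ g u) + η * α * ‖u‖ ^ 2 ≤ 2 * η * f y := by
      linarith [mul_le_mul_of_nonneg_left hfy hη.le]
    have h3 : η * L * ‖d‖ ^ 2 ≤ 2 / 3 * ‖d‖ ^ 2 :=
      mul_le_mul_of_nonneg_right hηL (sq_nonneg _)
    have h4 := mul_le_mul_of_nonneg_left h2 (by linarith : (0 : ℝ) ≤ δ / 3)
    have h5 := mul_le_mul_of_nonneg_left hCauchy (by linarith : (0 : ℝ) ≤ (1 - c) / 3)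
    have h6 : 0 ≤ c * δ ^ 2 * ‖u‖ ^ 2 := by positivity
    have h7 : 0 ≤ (c * (1 - δ) + δ) * ‖d‖ ^ 2 :=
      mul_nonneg (add_nonneg (mul_nonneg hc.le (by linarith)) hδ0.le) (sq_nonneg _)
    have e : η * α = δ + c := by rw [hδ]; ring
    rw [e] at h4
    linarith
  have : f x - f y - (1 - δ / 3) * (f θ - f y) ≤ 0 := by
    by_contra hcon
    push Not at hcon
    have := mul_pos (mul_pos two_pos hη) hcon
    linarith
  linarith

/-- Geometric convergence of the function values of hard-thresholded gradient descent. -/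
lemma IsIHTRun.sub_le_pow {f Q : Vec p → ℝ}
    (hexp : ∀ θ d, f (θ + d) = f θ + inner ℝ (gradient f θ) d + 1 / 2 * Q d)
    {s t : ℕ} {α L η c : ℝ} (hη : 0 < η) (hηL : η * L ≤ 2 / 3) (hc : 0 < c)
    (hcα : c < η * α) (hα1 : η * α ≤ 1) (hst : (t : ℝ) ≤ c ^ 2 * (s - t))
    (hlo : ∀ d, l0 d ≤ 2 * s + t → α * ‖d‖ ^ 2 ≤ Q d)
    (hup : ∀ d, l0 d ≤ 2 * s + t → Q d ≤ L * ‖d‖ ^ 2)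
    {θ : ℕ → Vec p} {y : Vec p} (hy : l0 y ≤ t) (hθ : IsIHTRun f s η θ) (k : ℕ) :
    l0 (θ (k + 1)) ≤ s ∧
      f (θ (k + 1)) - f y ≤ (1 - (η * α - c) / 3) ^ k * (f (θ 1) - f y) := by
  induction k with
  | zero => simp [hθ.1, l0_zero]
  | succ k ih =>
    have hx := hθ.2 (k + 1) (by omega)
    refine ⟨hx.l0_le, ?_⟩
    refine (hardThreshold_step_contraction hexp hη hηL hc hcα hα1 hst hlo hup ih.1 hy hx).trans ?_
    rw [pow_succ', mul_assoc]
    exact mul_le_mul_of_nonneg_left ih.2 (by linarith)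

/-- A function that grows quadratically along sparse vectors has a sparse minimizer. -/
lemma exists_isSparseMinimizer {f Q : Vec p → ℝ} (hf : Continuous f)
    (hexp : ∀ θ d, f (θ + d) = f θ + inner ℝ (gradient f θ) d + 1 / 2 * Q d)
    {t : ℕ} {α : ℝ} (hα : 0 < α) (hlo : ∀ d, l0 d ≤ t → α * ‖d‖ ^ 2 ≤ Q d) :
    ∃ y, IsSparseMinimizer f t y := by
  -- Beyond this radius the quadratic growth beats the linear term, so a sparse `θ` there has value
  -- at least `f 0`.
  set R := 2 * ‖gradient f 0‖ / α
  have hclosed : IsClosed {v : Vec p | l0 v ≤ t} := by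
    -- The sparse vectors form a finite union of coordinate subspaces.
    have : {v : Vec p | l0 v ≤ t} =
        ⋃ S ∈ (Finset.univ.filter fun S : Finset (Fin p) => S.card ≤ t),
          {v : Vec p | ∀ j ∉ S, v j = 0} := by
      ext v
      simp only [Set.mem_ofPred_eq, Finset.mem_filter, Finset.mem_univ, true_and, Set.mem_iUnion,
        exists_prop]
      constructor
      · intro h
        exact ⟨Finset.univ.filter fun i => v i ≠ 0, h, by simp⟩
      · rintro ⟨S, hS, h⟩
        exact (l0_le_card h).trans hS
    rw [this]
    refine isClosed_biUnion_finset fun S _ => ?_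
    simp only [Set.ofPred_forall]
    exact isClosed_iInter fun j => isClosed_iInter fun _ =>
      isClosed_eq (by fun_prop) continuous_const
  have hR : 0 ≤ R := by positivity
  have hcomp : IsCompact (Metric.closedBall (0 : Vec p) R ∩ {v | l0 v ≤ t}) :=
    (isCompact_closedBall _ _).inter_right hclosed
  obtain ⟨y, hy, hmin⟩ := hcomp.exists_isMinOn ⟨0, by simp [hR, l0_zero]⟩ hf.continuousOn
  refine ⟨y, hy.2, fun θ hθ => ?_⟩
  by_cases hb : ‖θ‖ ≤ R
  · exact hmin ⟨by simpa using hb, hθ⟩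
  · push Not at hb
    have h0 : f y ≤ f 0 := hmin ⟨by simp [hR], by simp [l0_zero]⟩
    have h1 := hexp 0 θ
    rw [zero_add] at h1
    have h2 := hlo θ hθ
    have h3 := abs_le.1 (abs_real_inner_le_norm (gradient f 0) θ)
    have h4 : 2 * ‖gradient f 0‖ < ‖θ‖ * α := (div_lt_iff₀ hα).1 hb
    have h5 : 0 ≤ ‖θ‖ := norm_nonneg _
    nlinarith [h3.1]

/-- Hölder between `ℓ^∞` and `ℓ¹`, then Cauchy-Schwarz on the support of `d`. -/
lemma inner_le_sqrt_mul_of_abs_le {g d : Vec p} {M : ℝ} {r : ℕ} (hM : ∀ j, |g j| ≤ M)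
    (hM0 : 0 ≤ M) (hd : l0 d ≤ r) : |inner ℝ g d| ≤ √r * M * ‖d‖ := by
  set U := Finset.univ.filter fun i => d i ≠ 0
  have h1 : |inner ℝ g d| ≤ ∑ j ∈ U, M * |d j| := by
    rw [inner_eq_sum]
    have : ∑ i, g i * d i = ∑ i ∈ U, g i * d i :=
      (Finset.sum_subset (Finset.subset_univ _) fun j _ hj => by
        simp only [U, Finset.mem_filter, Finset.mem_univ, true_and, not_not] at hj
        simp [hj]).symm
    rw [this]
    refine (Finset.abs_sum_le_sum_abs _ _).trans (Finset.sum_le_sum fun j _ => ?_)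
    rw [abs_mul]
    exact mul_le_mul_of_nonneg_right (hM j) (abs_nonneg _)
  have h2 : ∑ j ∈ U, |d j| ≤ √r * ‖d‖ := by
    rw [← Real.sqrt_sq (norm_nonneg d), ← Real.sqrt_mul (by positivity)]
    refine Real.le_sqrt_of_sq_le ?_
    refine (sq_sum_le_card_mul_sum_sq (s := U) (f := fun j => |d j|)).trans ?_
    have hr : (U.card : ℝ) ≤ r := by exact_mod_cast hd
    have hs : ∑ j ∈ U, |d j| ^ 2 ≤ ‖d‖ ^ 2 := by
      rw [norm_sq_eq_sum]
      simp only [sq_abs]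
      exact Finset.sum_le_sum_of_subset_of_nonneg (Finset.subset_univ _) fun _ _ _ => sq_nonneg _
    exact mul_le_mul hr hs (Finset.sum_nonneg fun _ _ => by positivity) (by positivity)
  rw [← Finset.mul_sum] at h1
  calc _ ≤ _ := h1
    _ ≤ M * (√r * ‖d‖) := mul_le_mul_of_nonneg_left h2 hM0
    _ = _ := by ring

lemma le_add_sqrt_of_quadratic_le {a b ε x : ℝ} (ha : 0 < a) (hb : 0 ≤ b) (hε : 0 ≤ ε)
    (h : a / 4 * x ^ 2 ≤ ε + b * x) : x ≤ 4 * b / a + 2 * √(ε / a) := by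
  set r := √(ε / a)
  have hr : 0 ≤ r := Real.sqrt_nonneg _
  have hr2 : r ^ 2 * a = ε := by rw [Real.sq_sqrt (by positivity)]; field_simp
  by_contra hcon
  push Not at hcon
  set w := 4 * b / a
  have hw : w * a = 4 * b := by simp only [w]; field_simp
  have hw0 : 0 ≤ w := by positivity
  have h1 : x ^ 2 ≤ 4 * r ^ 2 + w * x := by
    have : a * x ^ 2 ≤ a * (4 * r ^ 2 + w * x) := by nlinarith
    exact le_of_mul_le_mul_left this ha
  nlinarith [mul_nonneg hw0 hr]

/-- Distance to the true parameter, from the function value error. -/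
lemma norm_sub_le_of_sub_le {f Q : Vec p → ℝ}
    (hexp : ∀ θ d, f (θ + d) = f θ + inner ℝ (gradient f θ) d + 1 / 2 * Q d)
    {s t : ℕ} {a M ε : ℝ} (ha : 0 < a) (hε : 0 ≤ ε) (hM0 : 0 ≤ M)
    (hlo : ∀ d, l0 d ≤ s + t → a / 2 * ‖d‖ ^ 2 ≤ Q d)
    {θ y θbar : Vec p} (hθ : l0 θ ≤ s) (hbar : l0 θbar ≤ t) (hy : f y ≤ f θbar)
    (hM : ∀ j, |gradient f θbar j| ≤ M) (hf : f θ - f y ≤ ε) :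
    ‖θbar - θ‖ ≤ 4 * (√((s + t : ℕ) : ℝ) * M) / a + 2 * √(ε / a) := by
  rw [norm_sub_rev]
  have hd : l0 (θ - θbar) ≤ s + t := (l0_sub_le _ _).trans (by omega)
  refine le_add_sqrt_of_quadratic_le ha (by positivity) hε ?_
  -- Expanding at `θbar` rather than at the minimizer needs only the gradient at `θbar`; `f y ≤ f
  -- θbar` lets `ε` bound `f θ - f θbar` as well.
  have h1 := hexp θbar (θ - θbar)
  rw [add_sub_cancel] at h1
  have h2 := hlo _ hd
  have h3 := abs_le.1 (inner_le_sqrt_mul_of_abs_le hM hM0 hd)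
  linarith [h3.1]

end Deterministic

section Spectrum

/-! ### Quadratic forms and singular values -/

lemma inner_apply_self_eq_sum_eigenvalues {E : Type*} [NormedAddCommGroup E]
    [InnerProductSpace ℝ E] [FiniteDimensional ℝ E] {T : E →ₗ[ℝ] E} (hT : T.IsSymmetric) {n : ℕ}
    (hn : Module.finrank ℝ E = n) (v : E) :
    inner ℝ (T v) v =
      ∑ i, hT.eigenvalues hn i * inner ℝ (hT.eigenvectorBasis hn i) v ^ 2 := by
  rw [← (hT.eigenvectorBasis hn).sum_inner_mul_inner (T v) v]
  refine Finset.sum_congr rfl fun i _ => ?_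
  rw [hT v, hT.apply_eigenvectorBasis, inner_smul_right, real_inner_comm]
  simp
  ring

lemma mul_norm_sq_le_inner_of_le_eigenvalues {E : Type*} [NormedAddCommGroup E]
    [InnerProductSpace ℝ E] [FiniteDimensional ℝ E] {T : E →ₗ[ℝ] E} (hT : T.IsSymmetric) {n : ℕ}
    (hn : Module.finrank ℝ E = n) {c : ℝ} (hc : ∀ i, c ≤ hT.eigenvalues hn i) (v : E) :
    c * ‖v‖ ^ 2 ≤ inner ℝ (T v) v := by
  rw [inner_apply_self_eq_sum_eigenvalues hT hn,
    ← (hT.eigenvectorBasis hn).sum_sq_inner_right v, Finset.mul_sum]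
  exact Finset.sum_le_sum fun i _ => mul_le_mul_of_nonneg_right (hc i) (sq_nonneg _)

lemma inner_le_mul_norm_sq_of_eigenvalues_le {E : Type*} [NormedAddCommGroup E]
    [InnerProductSpace ℝ E] [FiniteDimensional ℝ E] {T : E →ₗ[ℝ] E} (hT : T.IsSymmetric) {n : ℕ}
    (hn : Module.finrank ℝ E = n) {c : ℝ} (hc : ∀ i, hT.eigenvalues hn i ≤ c) (v : E) :
    inner ℝ (T v) v ≤ c * ‖v‖ ^ 2 := by
  rw [inner_apply_self_eq_sum_eigenvalues hT hn,
    ← (hT.eigenvectorBasis hn).sum_sq_inner_right v, Finset.mul_sum]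
  exact Finset.sum_le_sum fun i _ => mul_le_mul_of_nonneg_right (hc i) (sq_nonneg _)

variable {p : ℕ} {A : Matrix (Fin p) (Fin p) ℝ}

lemma sigmaMin_nonneg : 0 ≤ sigmaMin A := LinearMap.singularValues_nonneg _ _

lemma sigmaMax_nonneg : 0 ≤ sigmaMax A := LinearMap.singularValues_nonneg _ _

lemma sigmaMin_le_sigmaMax : sigmaMin A ≤ sigmaMax A :=
  LinearMap.singularValues_antitone _ (Nat.zero_le _)

/-- The eigenvalues of `AᵀA` are the squared singular values, and `‖A v‖²` is its quadratic form. -/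
lemma sigmaMin_mul_norm_le (v : Vec p) :
    sigmaMin A * ‖v‖ ≤ ‖Matrix.toEuclideanLin A v‖ := by
  set T := Matrix.toEuclideanLin A
  have hn : Module.finrank ℝ (Vec p) = p := by simp
  have h := mul_norm_sq_le_inner_of_le_eigenvalues T.isSymmetric_adjoint_comp_self hn
    (c := sigmaMin A ^ 2) (fun i => by
      rw [← T.sq_singularValues_fin]
      exact pow_le_pow_left₀ sigmaMin_nonneg (T.singularValues_antitone (by omega)) 2) v
  rw [LinearMap.comp_apply, LinearMap.adjoint_inner_left, real_inner_self_eq_norm_sq,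
    ← mul_pow] at h
  exact le_of_sq_le_sq h (norm_nonneg _)

lemma norm_le_sigmaMax_mul (v : Vec p) :
    ‖Matrix.toEuclideanLin A v‖ ≤ sigmaMax A * ‖v‖ := by
  set T := Matrix.toEuclideanLin A
  have hn : Module.finrank ℝ (Vec p) = p := by simp
  have h := inner_le_mul_norm_sq_of_eigenvalues_le T.isSymmetric_adjoint_comp_self hn
    (c := sigmaMax A ^ 2) (fun i => by
      rw [← T.sq_singularValues_fin]
      exact pow_le_pow_left₀ (T.singularValues_nonneg _)
        (T.singularValues_antitone (Nat.zero_le _)) 2) v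
  rw [LinearMap.comp_apply, LinearMap.adjoint_inner_left, real_inner_self_eq_norm_sq,
    ← mul_pow] at h
  exact le_of_sq_le_sq h (mul_nonneg sigmaMax_nonneg (norm_nonneg _))

lemma inner_toEuclideanLin_le (v : Vec p) :
    inner ℝ (Matrix.toEuclideanLin A v) v ≤ sigmaMax A * ‖v‖ ^ 2 := by
  refine (real_inner_le_norm _ _).trans ?_
  rw [sq, ← mul_assoc]
  exact mul_le_mul_of_nonneg_right (norm_le_sigmaMax_mul v) (norm_nonneg _)

lemma inner_toEuclideanLin_eq (u v : Vec p) :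
    inner ℝ (Matrix.toEuclideanLin A u) v = WithLp.ofLp v ⬝ᵥ A.mulVec (WithLp.ofLp u) := by
  rw [inner_eq_dotProduct, dotProduct_comm]
  rfl

/-- On a unit eigenvector `‖A e‖` is the eigenvalue itself, by nonnegativity, so every eigenvalue
dominates the smallest singular value. -/
lemma sigmaMin_mul_norm_sq_le (hA : A.PosSemidef) (v : Vec p) :
    sigmaMin A * ‖v‖ ^ 2 ≤ inner ℝ (Matrix.toEuclideanLin A v) v := by
  set T := Matrix.toEuclideanLin A with hTdef
  have hn : Module.finrank ℝ (Vec p) = p := by simp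
  have hT : T.IsSymmetric := Matrix.isSymmetric_toEuclideanLin_iff.2 hA.1
  refine mul_norm_sq_le_inner_of_le_eigenvalues hT hn (fun i => ?_) v
  set e := hT.eigenvectorBasis hn i
  have he : ‖e‖ = 1 := (hT.eigenvectorBasis hn).orthonormal.1 i
  have h1 : T e = hT.eigenvalues hn i • e := hT.apply_eigenvectorBasis hn i
  have h2 : 0 ≤ hT.eigenvalues hn i := by
    have h3 : 0 ≤ inner ℝ (T e) e := by
      rw [inner_toEuclideanLin_eq]
      simpa using hA.dotProduct_mulVec_nonneg (WithLp.ofLp e)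
    rw [h1, inner_smul_left, real_inner_self_eq_norm_sq, he] at h3
    simpa using h3
  have h4 := sigmaMin_mul_norm_le (A := A) e
  rw [← hTdef, h1, norm_smul, he, Real.norm_of_nonneg h2] at h4
  linarith

lemma sigmaMin_pos (hp : 0 < p) (hA : A.PosDef) : 0 < sigmaMin A := by
  have hinj : Function.Injective (Matrix.toEuclideanLin A) := by
    rw [injective_iff_map_eq_zero]
    intro v hv
    by_contra hne
    have h := hA.dotProduct_mulVec_pos (x := WithLp.ofLp v) (by simpa using hne)
    have h2 := inner_toEuclideanLin_eq (A := A) v v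
    rw [hv, inner_zero_left] at h2
    simp only [star_trivial] at h
    linarith
  exact (LinearMap.injective_iff_forall_lt_finrank_singularValues_pos _).1 hinj _ (by simp; omega)

lemma norm_toEuclideanLin_le (v : Vec p) : ‖Matrix.toEuclideanLin A v‖ ≤ opNorm A * ‖v‖ :=
  (Matrix.toEuclideanCLM (n := Fin p) (𝕜 := ℝ) A).le_opNorm v

lemma sigmaMin_le_opNorm (hp : 0 < p) : sigmaMin A ≤ opNorm A := by
  have h := (sigmaMin_mul_norm_le (A := A) (EuclideanSpace.single ⟨0, hp⟩ 1)).trans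
    (norm_toEuclideanLin_le _)
  simpa using h

lemma one_le_kappa (hp : 0 < p) (hA : A.PosDef) : 1 ≤ kappa A :=
  (one_le_div (sigmaMin_pos hp hA)).2 sigmaMin_le_sigmaMax

end Spectrum

section Loss

variable {n p : ℕ}

/-! ### The corrected loss -/

/-- The gradient `Γ̂ θ - γ̂` of the corrected loss. -/
noncomputable def lossGradient (SigW : Matrix (Fin p) (Fin p) ℝ) (Xt : Matrix (Fin n) (Fin p) ℝ)
    (Y : Fin n → ℝ) (θ : Vec p) : Vec p :=
  Matrix.toEuclideanLin (GammaHat SigW Xt) θ - WithLp.toLp 2 (gammaHat Xt Y)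

lemma isSymm_GammaHat {SigW : Matrix (Fin p) (Fin p) ℝ} (hW : SigW.PosSemidef)
    (Xt : Matrix (Fin n) (Fin p) ℝ) : (GammaHat SigW Xt).IsHermitian := by
  have h := hW.1
  unfold Matrix.IsHermitian at h ⊢
  rw [Matrix.conjTranspose_eq_transpose_of_trivial] at h ⊢
  simp [GammaHat, Matrix.transpose_sub, Matrix.transpose_smul, Matrix.transpose_mul, h]

lemma correctedLoss_eq (SigW : Matrix (Fin p) (Fin p) ℝ) (Xt : Matrix (Fin n) (Fin p) ℝ)
    (Y : Fin n → ℝ) (θ : Vec p) : correctedLoss SigW Xt Y θ =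
      1 / 2 * inner ℝ (Matrix.toEuclideanLin (GammaHat SigW Xt) θ) θ -
        inner ℝ (WithLp.toLp 2 (gammaHat Xt Y)) θ := by
  rw [correctedLoss, inner_toEuclideanLin_eq, inner_eq_dotProduct]

lemma correctedLoss_add {SigW : Matrix (Fin p) (Fin p) ℝ} (hW : SigW.PosSemidef)
    (Xt : Matrix (Fin n) (Fin p) ℝ) (Y : Fin n → ℝ) (θ d : Vec p) :
    correctedLoss SigW Xt Y (θ + d) = correctedLoss SigW Xt Y θ +
      inner ℝ (lossGradient SigW Xt Y θ) d +
        1 / 2 * inner ℝ (Matrix.toEuclideanLin (GammaHat SigW Xt) d) d := by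
  have hT := Matrix.isSymmetric_toEuclideanLin_iff.2 (isSymm_GammaHat hW Xt)
  have h := hT d θ
  simp only [correctedLoss_eq, lossGradient, map_add, inner_add_left, inner_add_right,
    inner_sub_left, h, real_inner_comm]
  ring

lemma continuous_correctedLoss (SigW : Matrix (Fin p) (Fin p) ℝ) (Xt : Matrix (Fin n) (Fin p) ℝ)
    (Y : Fin n → ℝ) : Continuous (correctedLoss SigW Xt Y) := by
  have h : Continuous (Matrix.toEuclideanLin (GammaHat SigW Xt)) :=
    LinearMap.continuous_of_finiteDimensional _
  simp_rw [funext (correctedLoss_eq SigW Xt Y)]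
  fun_prop

/-- In the exact expansion the quadratic remainder is `O(‖d‖²)`, hence `o(‖d‖)`. -/
lemma gradient_correctedLoss {SigW : Matrix (Fin p) (Fin p) ℝ} (hW : SigW.PosSemidef)
    (Xt : Matrix (Fin n) (Fin p) ℝ) (Y : Fin n → ℝ) (θ : Vec p) :
    gradient (correctedLoss SigW Xt Y) θ = lossGradient SigW Xt Y θ := by
  refine HasGradientAt.gradient ?_
  rw [hasGradientAt_iff_isLittleO_nhds_zero]
  simp only [correctedLoss_add hW]
  have : (fun d : Vec p => 1 / 2 * inner ℝ (Matrix.toEuclideanLin (GammaHat SigW Xt) d) d)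
      =O[nhds 0] fun d => ‖d‖ ^ 2 := by
    refine Asymptotics.IsBigO.of_bound (1 / 2 * opNorm (GammaHat SigW Xt)) (.of_forall fun d => ?_)
    rw [norm_mul, mul_assoc, Real.norm_of_nonneg (by norm_num : (0 : ℝ) ≤ 1 / 2), norm_pow,
      norm_norm]
    refine mul_le_mul_of_nonneg_left ?_ (by norm_num)
    refine (abs_real_inner_le_norm _ _).trans ?_
    rw [sq, ← mul_assoc]
    exact mul_le_mul_of_nonneg_right (norm_toEuclideanLin_le d) (norm_nonneg _)
  exact (this.trans_isLittleO (Asymptotics.isLittleO_norm_pow_id one_lt_two)).congr_left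
    fun d => by ring

end Loss

/-! ### From restricted curvature and a small gradient to the guarantee -/

section Guarantee

variable {p : ℕ}

/-- The guarantee follows from restricted strong convexity and smoothness of the loss and a bound
on the entries of its gradient at the true parameter. -/
lemma ihtGuarantee_of_restricted (hp : 0 < p) {Sig : Matrix (Fin p) (Fin p) ℝ} (hSig : Sig.PosDef)
    {sStar : ℕ} {θbar : Vec p} (hbar : l0 θbar ≤ sStar) {f Q : Vec p → ℝ} (hf : Continuous f)
    (hexp : ∀ θ d, f (θ + d) = f θ + inner ℝ (gradient f θ) d + 1 / 2 * Q d)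
    {L M statErr : ℝ} (hL : 3 / 2 * sigmaMax Sig ≤ L) (hL' : L ≤ 7 / 4 * sigmaMax Sig)
    (hlo : ∀ d, l0 d ≤ rscLevel Sig sStar → sigmaMin Sig / 2 * ‖d‖ ^ 2 ≤ Q d)
    (hup : ∀ d, l0 d ≤ rscLevel Sig sStar → Q d ≤ 3 / 2 * sigmaMax Sig * ‖d‖ ^ 2)
    (hM : ∀ j, |gradient f θbar j| ≤ M)
    (herr : 160 * (kappa Sig / sigmaMin Sig) * √sStar * M ≤ statErr) :
    IHTGuarantee Sig sStar θbar f (2 / (3 * L)) statErr 20 := by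
  set s := iterSparsity Sig sStar with hs
  set κ := kappa Sig with hκ
  have hmin := sigmaMin_pos hp hSig
  have hmax : 0 < sigmaMax Sig := hmin.trans_le sigmaMin_le_sigmaMax
  have hκ1 : 1 ≤ κ := one_le_kappa hp hSig
  have hκ0 : 0 < κ := by linarith
  have hκmul : κ * sigmaMin Sig = sigmaMax Sig := div_mul_cancel₀ _ hmin.ne'
  have hL0 : 0 < L := by linarith
  have hk : rscLevel Sig sStar = 2 * s + sStar := rfl
  rw [hk] at hlo hup
  have hM0 : 0 ≤ M := (abs_nonneg _).trans (hM ⟨0, hp⟩)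
  have hsl : 1568 * κ ^ 2 * (sStar : ℝ) ≤ s := Nat.le_ceil _
  have hκt : (sStar : ℝ) ≤ κ ^ 2 * sStar :=
    le_mul_of_one_le_left (Nat.cast_nonneg _) (one_le_pow₀ hκ1)
  obtain ⟨y, hy⟩ := exists_isSparseMinimizer (t := sStar) hf hexp (half_pos hmin)
    fun d hd => hlo d (by omega)
  refine ⟨y, hy, fun θ hθ => ?_⟩
  have hηα : 2 / (3 * L) * (sigmaMin Sig / 2) = sigmaMin Sig / (3 * L) := by
    field_simp
  -- From `L ≤ (7/4) κ σ_min`.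
  have hηα2 : 4 / 21 / κ ≤ sigmaMin Sig / (3 * L) := by
    rw [div_le_div_iff₀ hκ0 (by positivity)]
    nlinarith
  -- The choice `c = 1 / (39 κ)` fits `s ≥ 1568 κ² s*`: then `s - s* ≥ 1567 κ² s*` and `1567 ≥ 39²`.
  -- It is also well below `4 / (21 κ)`, leaving a contraction gap of order `1 / κ`.
  have hc : (1 / 39 / κ : ℝ) < sigmaMin Sig / (3 * L) :=
    lt_of_lt_of_le (div_lt_div_of_pos_right (by norm_num) hκ0) hηα2
  have hconv := IsIHTRun.sub_le_pow (η := 2 / (3 * L)) (c := 1 / 39 / κ)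
    (α := sigmaMin Sig / 2) (L := 3 / 2 * sigmaMax Sig) (s := s) (t := sStar) hexp
    (by positivity)
    (by rw [div_mul_eq_mul_div, div_le_div_iff₀ (by positivity) (by norm_num)]; linarith)
    (by positivity) (by rw [hηα]; exact hc)
    (by rw [hηα, div_le_one (by positivity)]; linarith [sigmaMin_le_sigmaMax (A := Sig)])
    (by
      have h1 : 1567 * κ ^ 2 * (sStar : ℝ) ≤ s - sStar := by linarith
      have h2 := mul_le_mul_of_nonneg_left h1 (sq_nonneg (1 / 39 / κ))
      have h3 : (1 / 39 / κ) ^ 2 * (1567 * κ ^ 2 * (sStar : ℝ)) = 1567 / 1521 * sStar := by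
        field_simp; ring
      rw [h3] at h2
      linarith [(Nat.cast_nonneg sStar : (0 : ℝ) ≤ sStar)])
    hlo hup hy.1 hθ
  rw [hηα] at hconv
  constructor
  · intro τ hτ ε hε hfε
    obtain ⟨k, rfl⟩ : ∃ k, τ = k + 1 := ⟨τ - 1, by omega⟩
    have h := norm_sub_le_of_sub_le (s := s) (t := sStar) hexp hmin hε hM0
      (fun d hd => by
        have := hlo d (by omega)
        linarith) (hconv k).1 hbar (hy.2 θbar hbar) hM hfε
    refine h.trans (add_le_add_left ?_ _)
    -- For `s* ≥ 1` the rounded `s + s*` is at most `1570 κ² s*`, and `1570 ≤ 40²`; for `s* = 0`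
    -- both sides vanish.
    have hsq : √((s + sStar : ℕ) : ℝ) ≤ 40 * κ * √sStar := by
      refine Real.sqrt_le_iff.2 ⟨by positivity, ?_⟩
      rw [mul_pow, Real.sq_sqrt (Nat.cast_nonneg _)]
      rcases Nat.eq_zero_or_pos sStar with h0 | h0
      · have : s = 0 := by simp [hs, iterSparsity, h0]
        simp [this, h0]
      · have h1 : (1 : ℝ) ≤ sStar := by exact_mod_cast h0
        have h2 : (s : ℝ) < 1568 * κ ^ 2 * (sStar : ℝ) + 1 := Nat.ceil_lt_add_one (by positivity)
        push_cast
        nlinarith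
    calc 4 * (√((s + sStar : ℕ) : ℝ) * M) / sigmaMin Sig
        ≤ 4 * (40 * κ * √sStar * M) / sigmaMin Sig := by gcongr
      _ = 160 * (κ / sigmaMin Sig) * √sStar * M := by ring
      _ ≤ statErr := herr
  · intro ε hε τ hτ hlog
    obtain ⟨k, rfl⟩ : ∃ k, τ = k + 1 := ⟨τ - 1, by omega⟩
    have h := (hconv k).2
    have he1 : 0 ≤ f (θ 1) - f y := by
      have := hy.2 (θ 1) (by rw [hθ.1, l0_zero]; omega)
      linarith
    set lam := (sigmaMin Sig / (3 * L) - 1 / 39 / κ) / 3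
    -- `(4/21 - 1/39) / 3 ≥ 1/20`, which is why the iteration constant is `20`.
    have hlam : 1 / 20 / κ ≤ lam := by
      have h2 : 0 < κ⁻¹ := by positivity
      simp only [lam]
      rw [div_eq_mul_inv _ κ] at hηα2 ⊢
      rw [div_eq_mul_inv _ κ]
      linarith
    have hlam0 : 0 ≤ 1 - lam := by
      have : sigmaMin Sig / (3 * L) ≤ 1 := by
        rw [div_le_one (by positivity)]; linarith [sigmaMin_le_sigmaMax (A := Sig)]
      have h3 : (0 : ℝ) ≤ 1 / 39 / κ := by positivity
      simp only [lam]
      linarith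
    -- If the start is already optimal, `Real.log 0 = 0` carries no information, but the contraction
    -- bound is then zero.
    rcases he1.eq_or_lt with h0 | h0
    · rw [← h0, mul_zero] at h
      exact h.trans hε.le
    refine h.trans ?_
    have h4 : (1 - lam) ^ k ≤ Real.exp (-(k * lam)) := by
      rw [← mul_neg, Real.exp_nat_mul]
      exact pow_le_pow_left₀ hlam0 (by linarith [Real.add_one_le_exp (-lam)]) k
    have h5 : Real.log ((f (θ 1) - f y) / ε) ≤ k * lam := by
      push_cast at hlog
      have h6 : 20 * κ * Real.log ((f (θ 1) - f y) / ε) ≤ k := by linarith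
      have h7 : Real.log ((f (θ 1) - f y) / ε) ≤ k * (1 / 20 / κ) := by
        have e : (k : ℝ) * (1 / 20 / κ) = k / (20 * κ) := by field_simp
        rw [e, le_div_iff₀ (by positivity)]
        linarith
      exact h7.trans (mul_le_mul_of_nonneg_left hlam (Nat.cast_nonneg _))
    have h8 : (f (θ 1) - f y) / ε ≤ Real.exp (k * lam) :=
      (Real.log_le_iff_le_exp (by positivity)).1 h5
    rw [div_le_iff₀ hε] at h8
    calc (1 - lam) ^ k * (f (θ 1) - f y) ≤ Real.exp (-(k * lam)) * (Real.exp (k * lam) * ε) :=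
          mul_le_mul h4 h8 he1 (Real.exp_nonneg _)
      _ = ε := by rw [← mul_assoc, ← Real.exp_add]; simp

end Guarantee

section Bernstein

/-! ### Concentration of averages of products of sub-Gaussian variables -/

variable {Ω : Type*} [MeasurableSpace Ω] {μ : Measure Ω}

lemma integral_exp_sq_div_four_gaussianReal :
    Integrable (fun g : ℝ => Real.exp (g ^ 2 / 4)) (gaussianReal 0 1) ∧
      ∫ g, Real.exp (g ^ 2 / 4) ∂(gaussianReal 0 1) = √2 := by
  have e : (fun x : ℝ => gaussianPDFReal 0 1 x • Real.exp (x ^ 2 / 4)) =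
      fun x => (√(2 * Real.pi))⁻¹ * Real.exp (-(1 / 4) * x ^ 2) := by
    ext x
    simp only [gaussianPDFReal, smul_eq_mul, NNReal.coe_one, mul_one, sub_zero]
    rw [mul_assoc, ← Real.exp_add]
    congr 2
    ring
  have h2 : ∫ g, Real.exp (g ^ 2 / 4) ∂(gaussianReal 0 1) = √2 := by
    rw [integral_gaussianReal_eq_integral_smul one_ne_zero, e, integral_const_mul,
      integral_gaussian, ← Real.sqrt_inv, ← Real.sqrt_mul (by positivity)]
    congr 1
    field_simp
    norm_num
  refine ⟨?_, h2⟩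
  -- A non-integrable function would have Bochner integral `0`, not `√2`.
  by_contra hni
  rw [integral_undef hni] at h2
  exact absurd h2.symm (by positivity)

/-- Gaussian linearization: `exp (x² / (4c))` is the mean of `exp (a x g)` over a standard Gaussian
`g`, with `a² = 1 / (2c)`. After Tonelli the sub-Gaussian bound leaves `𝔼 exp (g² / 4) = √2`. -/
lemma lintegral_exp_sq_div_le [IsProbabilityMeasure μ] {X : Ω → ℝ} {c : ℝ≥0} (hc : c ≠ 0)
    (hX : HasSubgaussianMGF X c μ) :
    ∫⁻ ω, ENNReal.ofReal (Real.exp (X ω ^ 2 / (4 * c))) ∂μ ≤ ENNReal.ofReal (√2) := by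
  have hc0 : (0 : ℝ) < c := by positivity
  set a : ℝ := √(1 / (2 * c))
  have ha : a ^ 2 = 1 / (2 * c) := Real.sq_sqrt (by positivity)
  have h1 : ∀ x : ℝ, ENNReal.ofReal (Real.exp (x ^ 2 / (4 * c))) =
      ∫⁻ g, ENNReal.ofReal (Real.exp (a * x * g)) ∂(gaussianReal 0 1) := by
    intro x
    rw [← ofReal_integral_eq_lintegral_ofReal (integrable_exp_mul_gaussianReal _)
      (.of_forall fun _ => (Real.exp_pos _).le)]
    have := congrFun (mgf_fun_id_gaussianReal (μ := 0) (v := 1)) (a * x)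
    rw [mgf] at this
    rw [this]
    congr 2
    rw [mul_pow, ha]
    simp only [NNReal.coe_one]
    field_simp
    ring
  have h2 : ∀ g : ℝ, ∫⁻ ω, ENNReal.ofReal (Real.exp (a * X ω * g)) ∂μ ≤
      ENNReal.ofReal (Real.exp (g ^ 2 / 4)) := by
    intro g
    have e : ∀ ω, a * X ω * g = a * g * X ω := fun ω => by ring
    simp only [e]
    rw [← ofReal_integral_eq_lintegral_ofReal (hX.integrable_exp_mul _)
      (.of_forall fun _ => (Real.exp_pos _).le)]
    refine ENNReal.ofReal_le_ofReal ((hX.mgf_le (a * g)).trans (Real.exp_le_exp.2 (le_of_eq ?_)))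
    rw [mul_pow, ha]
    field_simp
    ring
  simp only [h1]
  rw [lintegral_lintegral_swap]
  · refine (lintegral_mono h2).trans (le_of_eq ?_)
    rw [← ofReal_integral_eq_lintegral_ofReal integral_exp_sq_div_four_gaussianReal.1
      (.of_forall fun _ => (Real.exp_pos _).le), integral_exp_sq_div_four_gaussianReal.2]
  · have hXm : AEMeasurable (fun z : Ω × ℝ => X z.1) (μ.prod (gaussianReal 0 1)) :=
      hX.aemeasurable.comp_fst
    have : AEMeasurable (fun z : Ω × ℝ => a * X z.1 * z.2) (μ.prod (gaussianReal 0 1)) :=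
      (hXm.const_mul a).mul measurable_snd.aemeasurable
    exact this.exp.ennreal_ofReal

lemma integrable_exp_sq_div [IsProbabilityMeasure μ] {X : Ω → ℝ} {c : ℝ≥0} (hc : c ≠ 0)
    (hX : HasSubgaussianMGF X c μ) :
    Integrable (fun ω => Real.exp (X ω ^ 2 / (4 * c))) μ ∧
      ∫ ω, Real.exp (X ω ^ 2 / (4 * c)) ∂μ ≤ 3 / 2 := by
  have hm : AEStronglyMeasurable (fun ω => Real.exp (X ω ^ 2 / (4 * c))) μ :=
    ((hX.aemeasurable.pow_const 2).div_const _).exp.aestronglyMeasurable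
  have h := lintegral_exp_sq_div_le hc hX
  have h0 : 0 ≤ᵐ[μ] fun ω => Real.exp (X ω ^ 2 / (4 * c)) :=
    .of_forall fun _ => (Real.exp_pos _).le
  refine ⟨(lintegral_ofReal_ne_top_iff_integrable hm h0).1
    (h.trans_lt ENNReal.ofReal_lt_top).ne, ?_⟩
  rw [integral_eq_lintegral_of_nonneg_ae h0 hm]
  refine (ENNReal.toReal_mono ENNReal.ofReal_ne_top h).trans ?_
  rw [ENNReal.toReal_ofReal (Real.sqrt_nonneg _)]
  exact Real.sqrt_le_iff.2 (by norm_num)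

/-- AM-GM twice, in the exponent and then on the product of exponentials, reduces to the two
square-exponential moments; no independence of `X` and `Y` is involved. -/
lemma integrable_exp_abs_mul [IsProbabilityMeasure μ] {X Y : Ω → ℝ} {cX cY : ℝ≥0}
    (hcX : cX ≠ 0) (hcY : cY ≠ 0) (hX : HasSubgaussianMGF X cX μ)
    (hY : HasSubgaussianMGF Y cY μ) :
    Integrable (fun ω => Real.exp (|X ω * Y ω| / (4 * √(cX * cY : ℝ)))) μ ∧
      ∫ ω, Real.exp (|X ω * Y ω| / (4 * √(cX * cY : ℝ))) ∂μ ≤ 3 / 2 := by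
  obtain ⟨hX1, hX2⟩ := integrable_exp_sq_div hcX hX
  obtain ⟨hY1, hY2⟩ := integrable_exp_sq_div hcY hY
  have hx0 : (0 : ℝ) < cX := by positivity
  have hy0 : (0 : ℝ) < cY := by positivity
  have hle : ∀ ω, Real.exp (|X ω * Y ω| / (4 * √(cX * cY : ℝ))) ≤
      (Real.exp (X ω ^ 2 / (4 * cX)) + Real.exp (Y ω ^ 2 / (4 * cY))) / 2 := by
    intro ω
    set u := |X ω| / √cX
    set w := |Y ω| / √cY
    have eu : X ω ^ 2 / (4 * cX) = u ^ 2 / 4 := by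
      rw [div_pow, sq_abs, Real.sq_sqrt hx0.le]; field_simp
    have ew : Y ω ^ 2 / (4 * cY) = w ^ 2 / 4 := by
      rw [div_pow, sq_abs, Real.sq_sqrt hy0.le]; field_simp
    have euw : |X ω * Y ω| / (4 * √(cX * cY : ℝ)) = u * w / 4 := by
      rw [abs_mul, Real.sqrt_mul hx0.le]
      have := Real.sqrt_pos.2 hx0
      have := Real.sqrt_pos.2 hy0
      simp only [u, w]
      field_simp
    rw [eu, ew, euw]
    have h1 : Real.exp (u * w / 4) ≤ Real.exp (u ^ 2 / 8) * Real.exp (w ^ 2 / 8) := by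
      rw [← Real.exp_add]
      exact Real.exp_le_exp.2 (by nlinarith [sq_nonneg (u - w)])
    have h2 : ∀ r : ℝ, Real.exp (r ^ 2 / 4) = Real.exp (r ^ 2 / 8) ^ 2 := fun r => by
      rw [← Real.exp_nat_mul]; congr 1; push_cast; ring
    rw [h2, h2]
    nlinarith [sq_nonneg (Real.exp (u ^ 2 / 8) - Real.exp (w ^ 2 / 8))]
  have hint : Integrable (fun ω => (Real.exp (X ω ^ 2 / (4 * cX)) +
      Real.exp (Y ω ^ 2 / (4 * cY))) / 2) μ := (hX1.add hY1).div_const 2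
  have hint2 : Integrable (fun ω => Real.exp (|X ω * Y ω| / (4 * √(cX * cY : ℝ)))) μ := by
    refine hint.mono' ?_ (.of_forall fun ω => ?_)
    · have hXY : AEMeasurable (fun ω => X ω * Y ω) μ := hX.aemeasurable.mul hY.aemeasurable
      exact (hXY.abs.div_const _).exp.aestronglyMeasurable
    · rw [Real.norm_of_nonneg (Real.exp_pos _).le]
      exact hle ω
  refine ⟨hint2, (integral_mono hint2 hint hle).trans ?_⟩
  rw [integral_div, integral_add hX1 hY1]
  linarith

lemma exp_le_one_add_add_sq_mul (x : ℝ) : Real.exp x ≤ 1 + x + x ^ 2 * Real.exp |x| := by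
  rcases le_total 0 x with hx | hx
  · rw [abs_of_nonneg hx]
    have h1 : Real.exp x - 1 ≤ x * Real.exp x := by
      have h := mul_le_mul_of_nonneg_right (Real.add_one_le_exp (-x)) (Real.exp_pos x).le
      rw [← Real.exp_add] at h
      simp only [neg_add_cancel, Real.exp_zero] at h
      linarith
    nlinarith [mul_le_mul_of_nonneg_left h1 hx]
  · have h1 : Real.exp x ≤ 1 + x + x ^ 2 := by
      have h := mul_le_mul_of_nonneg_right (Real.add_one_le_exp (-x)) (Real.exp_pos x).le
      rw [← Real.exp_add] at h
      simp only [neg_add_cancel, Real.exp_zero] at h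
      have h2 : (-x + 1) * Real.exp x ≤ (-x + 1) * (1 + x + x ^ 2) := by
        nlinarith [mul_nonneg (neg_nonneg.2 hx) (sq_nonneg x)]
      exact le_of_mul_le_mul_left h2 (by linarith)
    have h2 : x ^ 2 * 1 ≤ x ^ 2 * Real.exp |x| :=
      mul_le_mul_of_nonneg_left (Real.one_le_exp (abs_nonneg x)) (sq_nonneg x)
    linarith

/-- Moment generating function of a variable with an exponential moment, near the origin. -/
lemma integral_exp_mul_sub_le [IsProbabilityMeasure μ] {V : Ω → ℝ} {b : ℝ} (hb : 0 < b)
    (hV : AEStronglyMeasurable V μ)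
    (hint : Integrable (fun ω => Real.exp (2 * b * |V ω|)) μ)
    (hle : ∫ ω, Real.exp (2 * b * |V ω|) ∂μ ≤ 3 / 2) {l : ℝ} (hl : |l| ≤ b) :
    Integrable (fun ω => Real.exp (l * (V ω - ∫ ω, V ω ∂μ))) μ ∧
      ∫ ω, Real.exp (l * (V ω - ∫ ω, V ω ∂μ)) ∂μ ≤ Real.exp (3 * l ^ 2 / b ^ 2) := by
  have hVint : Integrable V μ := by
    refine (hint.div_const (2 * b)).mono' hV (.of_forall fun ω => ?_)
    rw [Real.norm_eq_abs, le_div_iff₀ (by positivity)]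
    linarith [Real.add_one_le_exp (2 * b * |V ω|)]
  have hpt : ∀ ω, Real.exp (l * V ω) ≤
      1 + l * V ω + 2 * l ^ 2 / b ^ 2 * Real.exp (2 * b * |V ω|) := by
    intro ω
    refine (exp_le_one_add_add_sq_mul _).trans (add_le_add_right ?_ _)
    have h1 : |l * V ω| ≤ b * |V ω| := by
      rw [abs_mul]; exact mul_le_mul_of_nonneg_right hl (abs_nonneg _)
    -- Half of the exponent `2 b |V|` absorbs the square, the other half absorbs `exp |l V|`.
    have h2 : (b * |V ω|) ^ 2 ≤ 2 * Real.exp (b * |V ω|) := by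
      have h0 : 0 ≤ b * |V ω| := by positivity
      linarith [Real.quadratic_le_exp_of_nonneg h0]
    have e : Real.exp (2 * b * |V ω|) = Real.exp (b * |V ω|) * Real.exp (b * |V ω|) := by
      rw [← Real.exp_add]; congr 1; ring
    have e2 : (l * V ω) ^ 2 = l ^ 2 / b ^ 2 * (b * |V ω|) ^ 2 := by
      rw [mul_pow b, sq_abs]; field_simp
    rw [e, e2]
    calc l ^ 2 / b ^ 2 * (b * |V ω|) ^ 2 * Real.exp |l * V ω|
        ≤ l ^ 2 / b ^ 2 * (2 * Real.exp (b * |V ω|)) * Real.exp (b * |V ω|) := by gcongr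
      _ = _ := by ring
  have hbd : Integrable (fun ω => 1 + l * V ω + 2 * l ^ 2 / b ^ 2 * Real.exp (2 * b * |V ω|)) μ :=
    ((integrable_const 1).add (hVint.const_mul l)).add (hint.const_mul _)
  have hexp : Integrable (fun ω => Real.exp (l * V ω)) μ := by
    refine hbd.mono' (hV.aemeasurable.const_mul l).exp.aestronglyMeasurable (.of_forall fun ω => ?_)
    rw [Real.norm_of_nonneg (Real.exp_pos _).le]
    exact hpt ω
  set m := ∫ ω, V ω ∂μ
  have e : (fun ω => Real.exp (l * (V ω - m))) = fun ω => Real.exp (-(l * m)) * Real.exp (l * V ω) := by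
    ext ω
    rw [← Real.exp_add]; congr 1; ring
  rw [e]
  refine ⟨hexp.const_mul _, ?_⟩
  rw [integral_const_mul]
  have h3 : ∫ ω, Real.exp (l * V ω) ∂μ ≤ 1 + l * m + 3 * l ^ 2 / b ^ 2 := by
    refine (integral_mono hexp hbd hpt).trans ?_
    have h1V : Integrable (fun ω => 1 + l * V ω) μ := (integrable_const 1).add (hVint.const_mul l)
    rw [integral_add h1V (hint.const_mul _),
      integral_add (integrable_const 1) (hVint.const_mul l), integral_const_mul,
      integral_const_mul]
    simp only [integral_const, probReal_univ, smul_eq_mul, mul_one]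
    have := mul_le_mul_of_nonneg_left hle (by positivity : 0 ≤ 2 * l ^ 2 / b ^ 2)
    have e4 : 2 * l ^ 2 / b ^ 2 * (3 / 2) = 3 * l ^ 2 / b ^ 2 := by ring
    linarith
  calc Real.exp (-(l * m)) * ∫ ω, Real.exp (l * V ω) ∂μ
      ≤ Real.exp (-(l * m)) * Real.exp (l * m + 3 * l ^ 2 / b ^ 2) := by
        refine mul_le_mul_of_nonneg_left (h3.trans ?_) (Real.exp_pos _).le
        linarith [Real.add_one_le_exp (l * m + 3 * l ^ 2 / b ^ 2)]
    _ = _ := by rw [← Real.exp_add]; congr 1; ring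

/-- One-sided Bernstein bound. -/
lemma measure_le_sum_sub_le [IsProbabilityMeasure μ] {n : ℕ} {V : Fin n → Ω → ℝ} {b t : ℝ}
    (hb : 0 < b) (hV : ∀ i, Measurable (V i)) (hind : iIndepFun V μ)
    (hint : ∀ i, Integrable (fun ω => Real.exp (2 * b * |V i ω|)) μ)
    (hle : ∀ i, ∫ ω, Real.exp (2 * b * |V i ω|) ∂μ ≤ 3 / 2) (ht : 0 ≤ t) (htb : t * b ≤ 6) :
    μ.real {ω | n * t ≤ ∑ i, (V i ω - ∫ ω, V i ω ∂μ)} ≤ Real.exp (-(n * (b * t) ^ 2 / 12)) := by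
  set U : Fin n → Ω → ℝ := fun i ω => V i ω - ∫ ω, V i ω ∂μ
  -- Minimizer of `3 l² / b² - l t`, with value `-(b t)² / 12`; the hypothesis `t b ≤ 6` says
  -- exactly that `l` stays in the admissible range.
  set l := b ^ 2 * t / 6
  have hl0 : 0 ≤ l := by positivity
  have hlb : |l| ≤ b := by
    rw [abs_of_nonneg hl0]
    simp only [l]
    nlinarith
  have hU : ∀ i, Measurable (U i) := fun i => (hV i).sub_const _
  have hUind : iIndepFun U μ := hind.comp (fun i x => x - ∫ ω, V i ω ∂μ) fun i => by fun_prop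
  have hmgf := fun i => integral_exp_mul_sub_le hb (hV i).aestronglyMeasurable (hint i) (hle i) hlb
  have hsum : Integrable (fun ω => Real.exp (l * (∑ i, U i) ω)) μ :=
    hUind.integrable_exp_mul_sum hU fun i _ => (hmgf i).1
  have h := measure_ge_le_exp_mul_mgf (X := ∑ i, U i) (μ := μ) (n * t) hl0 hsum
  rw [hUind.mgf_sum hU] at h
  have hprod : ∏ i, mgf (U i) μ l ≤ Real.exp (3 * l ^ 2 / b ^ 2) ^ n := by
    refine (Finset.prod_le_prod (fun i _ => mgf_nonneg) fun i _ => (hmgf i).2).trans ?_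
    simp
  simp only [Finset.sum_apply] at h
  refine h.trans ((mul_le_mul_of_nonneg_left hprod (Real.exp_pos _).le).trans (le_of_eq ?_))
  rw [← Real.exp_nat_mul, ← Real.exp_add]
  congr 1
  simp only [l]
  field_simp
  ring

/-- Two-sided Bernstein bound for products of sub-Gaussian variables. -/
lemma measure_lt_abs_average_mul_sub_le [IsProbabilityMeasure μ] {n : ℕ} (hn : 0 < n)
    {X Y : Fin n → Ω → ℝ} {cX cY : ℝ≥0} (hXm : ∀ i, Measurable (X i))
    (hYm : ∀ i, Measurable (Y i)) (hX : ∀ i, HasSubgaussianMGF (X i) cX μ)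
    (hY : ∀ i, HasSubgaussianMGF (Y i) cY μ) (hind : iIndepFun (fun i ω => X i ω * Y i ω) μ)
    {m : ℝ} (hm : ∀ i, ∫ ω, X i ω * Y i ω ∂μ = m) {r : ℝ} (hr : 0 ≤ r) (hr' : r ≤ 48) :
    μ.real {ω | √(cX * cY : ℝ) * r < |(n : ℝ)⁻¹ * ∑ i, X i ω * Y i ω - m|} ≤
      2 * Real.exp (-(n * r ^ 2 / 768)) := by
  have hn0 : (0 : ℝ) < n := by exact_mod_cast hn
  -- A zero proxy forces the product to vanish almost surely; the normalization by `√(cX cY)` below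
  -- needs it positive.
  by_cases h0 : cX = 0 ∨ cY = 0
  · have hz : ∀ i, (fun ω => X i ω * Y i ω) =ᵐ[μ] 0 := by
      intro i
      rcases h0 with h0 | h0
      · have := (h0 ▸ hX i).ae_eq_zero_of_hasSubgaussianMGF_zero
        filter_upwards [this] with ω hω
        simp [hω]
      · have := (h0 ▸ hY i).ae_eq_zero_of_hasSubgaussianMGF_zero
        filter_upwards [this] with ω hω
        simp [hω]
    have hm0 : m = 0 := by
      rw [← hm ⟨0, hn⟩, integral_congr_ae (hz _)]
      simp
    have : μ {ω | √(cX * cY : ℝ) * r < |(n : ℝ)⁻¹ * ∑ i, X i ω * Y i ω - m|} = 0 := by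
      rw [measure_eq_zero_iff_ae_notMem]
      filter_upwards [ae_all_iff.2 hz] with ω hω
      have : ∑ i, X i ω * Y i ω = 0 := Finset.sum_eq_zero fun i _ => hω i
      simp only [this, hm0, mul_zero, sub_zero, abs_zero, not_lt]
      positivity
    rw [measureReal_def, this]
    simp only [ENNReal.toReal_zero]
    positivity
  push Not at h0
  obtain ⟨hcX, hcY⟩ := h0
  set B := √(cX * cY : ℝ)
  have hB : 0 < B := Real.sqrt_pos.2 (by positivity)
  -- Makes `2 b |XY|` the exponent of `integrable_exp_abs_mul`. With `t = B r` one has `b t = r /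
  -- 8`, whence the `768 = 12 · 64` and the range `r ≤ 48`.
  set b := 1 / (8 * B)
  have hb : 0 < b := by positivity
  have hbB : b * B = 1 / 8 := by simp only [b]; field_simp
  have e : ∀ x : ℝ, 2 * b * x = x / (4 * B) := fun x => by simp only [b]; field_simp; ring
  have hXY := fun i => integrable_exp_abs_mul hcX hcY (hX i) (hY i)
  have hmeas : ∀ i, Measurable (fun ω => X i ω * Y i ω) := fun i =>
    (hXm i).mul (hYm i)
  have htb : B * r * b ≤ 6 := by
    have : B * r * b = r * (b * B) := by ring
    rw [this, hbB]
    linarith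
  have eexp : -(n * (b * (B * r)) ^ 2 / 12) = -(n * r ^ 2 / 768) := by
    rw [← mul_assoc, hbB]; ring
  have hp := measure_le_sum_sub_le (t := B * r) hb hmeas hind
    (fun i => by simpa only [e] using (hXY i).1) (fun i => by simpa only [e] using (hXY i).2)
    (by positivity) htb
  have hneg := measure_le_sum_sub_le (t := B * r) (V := fun i ω => -(X i ω * Y i ω)) hb
    (fun i => (hmeas i).neg) (hind.comp (fun _ x => -x) fun _ => by fun_prop)
    (fun i => by simpa only [e, abs_neg] using (hXY i).1)
    (fun i => by simpa only [e, abs_neg] using (hXY i).2) (by positivity) htb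
  rw [eexp] at hp hneg
  simp only [integral_neg, hm] at hp hneg
  have hsub : {ω | B * r < |(n : ℝ)⁻¹ * ∑ i, X i ω * Y i ω - m|} ⊆
      {ω | n * (B * r) ≤ ∑ i, (X i ω * Y i ω - m)} ∪
        {ω | n * (B * r) ≤ ∑ i, (-(X i ω * Y i ω) - -m)} := by
    intro ω hω
    simp only [Set.mem_ofPred_eq, Set.mem_union] at hω ⊢
    have h1 : ∑ i, (X i ω * Y i ω - m) = n * ((n : ℝ)⁻¹ * ∑ i, X i ω * Y i ω - m) := by
      rw [Finset.sum_sub_distrib]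
      simp
      field_simp
    have h2 : ∑ i, (-(X i ω * Y i ω) - -m) = n * -((n : ℝ)⁻¹ * ∑ i, X i ω * Y i ω - m) := by
      rw [Finset.sum_sub_distrib, Finset.sum_neg_distrib]
      simp
      field_simp
      ring
    rw [h1, h2]
    rcases lt_abs.1 hω with h | h
    · exact Or.inl (mul_le_mul_of_nonneg_left h.le hn0.le)
    · exact Or.inr (mul_le_mul_of_nonneg_left h.le hn0.le)
  calc _ ≤ _ := measureReal_mono hsub
    _ ≤ _ := measureReal_union_le _ _
    _ ≤ _ := by linarith

end Bernstein

section SubGaussian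

variable {Ω : Type*} [MeasurableSpace Ω] {μ : Measure Ω}

/-! ### Sub-Gaussian variables -/

lemma _root_.ProbabilityTheory.HasSubgaussianMGF.mono_proxy {X : Ω → ℝ} {c c' : ℝ≥0} (h : HasSubgaussianMGF X c μ)
    (hc : c ≤ c') : HasSubgaussianMGF X c' μ where
  integrable_exp_mul := h.integrable_exp_mul
  mgf_le t := (h.mgf_le t).trans (Real.exp_le_exp.2 (by gcongr))

/-- `mgf X - exp (c t² / 2)` is at most `0` and equals `0` at `t = 0`, so its derivative there, the
mean of `X`, vanishes. -/
lemma _root_.ProbabilityTheory.HasSubgaussianMGF.integral_eq_zero [IsProbabilityMeasure μ] {X : Ω → ℝ} {c : ℝ≥0}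
    (h : HasSubgaussianMGF X c μ) : ∫ ω, X ω ∂μ = 0 := by
  have h0 : (0 : ℝ) ∈ interior (integrableExpSet X μ) := by simp [h.integrableExpSet_eq_univ]
  have h1 : HasDerivAt (mgf X μ) (μ[X]) 0 := by
    simpa using hasDerivAt_mgf h0
  have h2 : HasDerivAt (fun t : ℝ => Real.exp (c * t ^ 2 / 2)) 0 0 := by
    have := (((hasDerivAt_pow 2 (0 : ℝ)).const_mul (c : ℝ)).div_const 2).exp
    simpa using this
  have h3 : IsLocalMax (fun t => mgf X μ t - Real.exp (c * t ^ 2 / 2)) 0 := by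
    refine .of_forall fun t => ?_
    have := h.mgf_le t
    simp only [mgf_zero, ne_eq, OfNat.ofNat_ne_zero, not_false_eq_true, zero_pow, mul_zero,
      zero_div, Real.exp_zero, sub_self]
    linarith
  have := h3.hasDerivAt_eq_zero (h1.sub h2)
  simpa using this

lemma hasSubgaussianMGF_id_gaussianReal (v : ℝ≥0) :
    HasSubgaussianMGF id v (gaussianReal 0 v) where
  integrable_exp_mul t := integrable_exp_mul_gaussianReal t
  mgf_le t := by rw [mgf_id_gaussianReal]; simp

lemma _root_.ProbabilityTheory.HasLaw.hasSubgaussianMGF_gaussianReal {X : Ω → ℝ} {v : ℝ≥0}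
    (h : HasLaw X (gaussianReal 0 v) μ) : HasSubgaussianMGF X v μ := by
  have := hasSubgaussianMGF_id_gaussianReal v
  rw [← h.map_eq] at this
  exact (HasSubgaussianMGF.id_map_iff h.aemeasurable).1 this

lemma _root_.ProbabilityTheory.HasSubgaussianMGF.memLp_two {X : Ω → ℝ} {c : ℝ≥0} (h : HasSubgaussianMGF X c μ) :
    MemLp X 2 μ := h.memLp 2

lemma integral_mul_eq_covariance [IsProbabilityMeasure μ] {X Y : Ω → ℝ} {cX cY : ℝ≥0}
    (hX : HasSubgaussianMGF X cX μ) (hY : HasSubgaussianMGF Y cY μ) :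
    ∫ ω, X ω * Y ω ∂μ = cov[X, Y; μ] := by
  rw [covariance_eq_sub hX.memLp_two hY.memLp_two, hX.integral_eq_zero, zero_mul, sub_zero]
  rfl

end SubGaussian

/-! ### One-dimensional marginals of the Gaussian feature noise -/

section Gaussian

variable {p : ℕ}

lemma inner_single_one_left (j : Fin p) (v : Vec p) :
    inner ℝ (EuclideanSpace.single j 1) v = v j := by
  rw [EuclideanSpace.inner_single_left]
  simp

lemma inner_toEuclideanLin_le_opNorm (A : Matrix (Fin p) (Fin p) ℝ) (u : Vec p) :
    inner ℝ u (Matrix.toEuclideanLin A u) ≤ opNorm A * ‖u‖ ^ 2 := by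
  refine (real_inner_le_norm _ _).trans ?_
  rw [sq, mul_comm, ← mul_assoc]
  exact mul_le_mul_of_nonneg_right (norm_toEuclideanLin_le u) (norm_nonneg _)

lemma covariance_inner_multivariateGaussian {S : Matrix (Fin p) (Fin p) ℝ} (hS : S.PosSemidef)
    (x y : Vec p) :
    cov[fun w => inner ℝ x w, fun w => inner ℝ y w; multivariateGaussian 0 S] =
      inner ℝ x (Matrix.toEuclideanLin S y) := by
  rw [← covarianceBilin_apply_eq_cov IsGaussian.memLp_two_id,
    covarianceBilin_multivariateGaussian hS, inner_eq_dotProduct]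
  rfl

lemma hasLaw_inner_multivariateGaussian {Ω : Type*} [MeasurableSpace Ω] {μ : Measure Ω}
    {S : Matrix (Fin p) (Fin p) ℝ} (hS : S.PosSemidef) {W : Ω → Vec p}
    (hW : HasLaw W (multivariateGaussian 0 S) μ) (u : Vec p) :
    HasLaw (fun ω => inner ℝ u (W ω))
      (gaussianReal 0 (inner ℝ u (Matrix.toEuclideanLin S u)).toNNReal) μ := by
  have h : HasLaw (fun w : Vec p => inner ℝ u w)
      (gaussianReal 0 (inner ℝ u (Matrix.toEuclideanLin S u)).toNNReal)
      (multivariateGaussian 0 S) := by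
    refine ⟨by fun_prop, ?_⟩
    have h1 := IsGaussian.map_eq_gaussianReal (μ := multivariateGaussian 0 S) (innerSL ℝ u)
    have h2 : (multivariateGaussian 0 S)[innerSL ℝ u] = 0 := by
      rw [(innerSL ℝ u).integral_comp_id_comm IsGaussian.integrable_id,
        integral_id_multivariateGaussian, map_zero]
    have h3 : Var[innerSL ℝ u; multivariateGaussian 0 S] =
        inner ℝ u (Matrix.toEuclideanLin S u) := by
      rw [← covariance_self (innerSL ℝ u).continuous.aemeasurable]
      exact covariance_inner_multivariateGaussian hS u u
    rw [h2, h3] at h1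
    exact h1
  exact h.fun_comp hW

lemma hasSubgaussianMGF_inner_multivariateGaussian {Ω : Type*} [MeasurableSpace Ω] {μ : Measure Ω}
    {S : Matrix (Fin p) (Fin p) ℝ} (hS : S.PosSemidef) {W : Ω → Vec p}
    (hW : HasLaw W (multivariateGaussian 0 S) μ) (u : Vec p) :
    HasSubgaussianMGF (fun ω => inner ℝ u (W ω)) (opNorm S * ‖u‖₊ ^ 2) μ := by
  refine HasSubgaussianMGF.mono_proxy
    (HasLaw.hasSubgaussianMGF_gaussianReal (hasLaw_inner_multivariateGaussian hS hW u)) ?_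
  rw [Real.toNNReal_le_iff_le_coe]
  exact inner_toEuclideanLin_le_opNorm S u

end Gaussian

section Model

/-! ### First and second moments in the additive noise model -/

variable {Ω : Type*} [MeasurableSpace Ω] {μ : Measure Ω} [IsProbabilityMeasure μ] {n p : ℕ}
  {K : ℝ≥0} {Sig SigW : Matrix (Fin p) (Fin p) ℝ} {σ : ℝ≥0} {X W : Fin n → Ω → Vec p}
  {ξ : Fin n → Ω → ℝ}

namespace IsAdditiveNoiseModel

lemma subgaussian_inner_X (h : IsAdditiveNoiseModel μ K Sig SigW σ X W ξ) (i : Fin n) (u : Vec p) :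
    HasSubgaussianMGF (fun ω => inner ℝ u (X i ω)) (K ^ 2 * opNorm Sig * ‖u‖₊ ^ 2) μ := by
  rcases eq_or_ne u 0 with rfl | hu
  · simp
  have hu0 : ‖u‖ ≠ 0 := norm_ne_zero_iff.2 hu
  have h1 := (h.subgaussian_X i (‖u‖⁻¹ • u) (by rw [norm_smul]; simp [hu0])).const_mul ‖u‖
  have e : (fun ω => ‖u‖ * inner ℝ (‖u‖⁻¹ • u) (X i ω)) = fun ω => inner ℝ u (X i ω) := by
    ext ω
    rw [inner_smul_left]
    simp only [map_inv₀, conj_trivial]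
    rw [mul_inv_cancel_left₀ hu0]
  rw [e] at h1
  refine HasSubgaussianMGF.mono_proxy h1 (le_of_eq ?_)
  refine NNReal.eq ?_
  change ‖u‖ ^ 2 * _ = _ * ‖u‖ ^ 2
  exact mul_comm _ _

/-- The sub-Gaussian variance proxy of the corrupted covariates. -/
lemma subgaussian_inner_add (h : IsAdditiveNoiseModel μ K Sig SigW σ X W ξ)
    (hW : SigW.PosSemidef) (i : Fin n) {u : Vec p} (hu : ‖u‖ ≤ 1) :
    HasSubgaussianMGF (fun ω => inner ℝ u (X i ω + W i ω)) (K ^ 2 * opNorm Sig + opNorm SigW)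
      μ := by
  have hind : IndepFun (fun ω => inner ℝ u (X i ω)) (fun ω => inner ℝ u (W i ω)) μ :=
    (h.indep_X_W i).comp (φ := fun x => inner ℝ u x) (ψ := fun x => inner ℝ u x)
      (by fun_prop) (by fun_prop)
  simp only [inner_add_right]
  have hu' : ‖u‖₊ ^ 2 ≤ 1 := pow_le_one₀ zero_le hu
  exact HasSubgaussianMGF.mono_proxy ((h.subgaussian_inner_X i u).add_of_indepFun
    (hasSubgaussianMGF_inner_multivariateGaussian hW (h.law_W i) u) hind)
    (add_le_add (mul_le_of_le_one_right' hu') (mul_le_of_le_one_right' hu'))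

omit [IsProbabilityMeasure μ] in
/-- The residual `⟨W, θ⟩ - ξ` is sub-Gaussian. -/
lemma subgaussian_inner_sub (h : IsAdditiveNoiseModel μ K Sig SigW σ X W ξ)
    (hW : SigW.PosSemidef) (i : Fin n) (θ : Vec p) :
    HasSubgaussianMGF (fun ω => inner ℝ θ (W i ω) - ξ i ω) (opNorm SigW * ‖θ‖₊ ^ 2 + σ ^ 2) μ := by
  have hind : IndepFun (fun ω => inner ℝ θ (W i ω)) (ξ i) μ :=
    (h.indep_XW_ξ i).comp (φ := fun x : Vec p × Vec p => inner ℝ θ x.2) (ψ := fun x => x)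
      (by fun_prop) (by fun_prop)
  exact (hasSubgaussianMGF_inner_multivariateGaussian hW (h.law_W i) θ).sub_of_indepFun
    (HasLaw.hasSubgaussianMGF_gaussianReal (h.law_ξ i)) hind

lemma covariance_inner_X (h : IsAdditiveNoiseModel μ K Sig SigW σ X W ξ) (i : Fin n)
    (x y : Vec p) :
    cov[fun ω => inner ℝ x (X i ω), fun ω => inner ℝ y (X i ω); μ] =
      inner ℝ x (Matrix.toEuclideanLin Sig y) := by
  have hm : ∀ j, MemLp (fun ω => X i ω j) 2 μ := fun j => by
    simpa only [inner_single_one_left] using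
      (h.subgaussian_inner_X i (EuclideanSpace.single j 1)).memLp_two
  simp only [inner_eq_sum]
  rw [covariance_fun_sum_fun_sum (fun j => (hm j).const_mul _) fun j => (hm j).const_mul _]
  refine Finset.sum_congr rfl fun j _ => ?_
  have : (Matrix.toEuclideanLin Sig y) j = ∑ k, Sig j k * y k := rfl
  rw [this, Finset.mul_sum]
  refine Finset.sum_congr rfl fun k _ => ?_
  rw [covariance_const_mul_left, covariance_const_mul_right, h.covariance_X]
  ring

omit [IsProbabilityMeasure μ] in
lemma covariance_inner_W (h : IsAdditiveNoiseModel μ K Sig SigW σ X W ξ) (hW : SigW.PosSemidef)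
    (i : Fin n) (x y : Vec p) :
    cov[fun ω => inner ℝ x (W i ω), fun ω => inner ℝ y (W i ω); μ] =
      inner ℝ x (Matrix.toEuclideanLin SigW y) := by
  rw [← covariance_inner_multivariateGaussian hW x y]
  exact (h.law_W i).covariance_fun_comp (f := fun w => inner ℝ x w) (g := fun w => inner ℝ y w)
    (by fun_prop) (by fun_prop)

lemma covariance_inner_X_W (h : IsAdditiveNoiseModel μ K Sig SigW σ X W ξ) (hW : SigW.PosSemidef)
    (i : Fin n) (x y : Vec p) :
    cov[fun ω => inner ℝ x (X i ω), fun ω => inner ℝ y (W i ω); μ] = 0 :=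
  ((h.indep_X_W i).comp (φ := fun w => inner ℝ x w) (ψ := fun w => inner ℝ y w)
    (by fun_prop) (by fun_prop)).covariance_eq_zero (h.subgaussian_inner_X i x).memLp_two
    (hasSubgaussianMGF_inner_multivariateGaussian hW (h.law_W i) y).memLp_two

/-- Unbiasedness of `Γ̂`: the corrupted covariates have second moment `Σ + Σ_W`. -/
lemma integral_inner_add_mul_inner_add (h : IsAdditiveNoiseModel μ K Sig SigW σ X W ξ)
    (hW : SigW.PosSemidef) (i : Fin n) {x y : Vec p} (hx : ‖x‖ ≤ 1) (hy : ‖y‖ ≤ 1) :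
    ∫ ω, inner ℝ x (X i ω + W i ω) * inner ℝ y (X i ω + W i ω) ∂μ =
      inner ℝ x (Matrix.toEuclideanLin Sig y) + inner ℝ x (Matrix.toEuclideanLin SigW y) := by
  rw [integral_mul_eq_covariance (h.subgaussian_inner_add hW i hx)
    (h.subgaussian_inner_add hW i hy)]
  have hX := fun u => (h.subgaussian_inner_X i u).memLp_two
  have hWi := fun u =>
    (hasSubgaussianMGF_inner_multivariateGaussian hW (h.law_W i) u).memLp_two
  simp only [inner_add_right]
  have e1 := covariance_add_left (hX x) (hWi x) ((hX y).add (hWi y))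
  have e2 := covariance_add_right (hX x) (hX y) (hWi y)
  have e3 := covariance_add_right (hWi x) (hX y) (hWi y)
  rw [e2, e3, h.covariance_inner_X, h.covariance_inner_X_W hW, h.covariance_inner_W hW,
    covariance_comm (fun ω => inner ℝ x (W i ω)), h.covariance_inner_X_W hW] at e1
  refine Eq.trans e1 (by ring)

/-- The residual correlates with the corrupted covariate only through `W`. This bias `Σ_W θ` is what
the correction in `Γ̂` subtracts, so the gradient at `θbar` is centred. -/
lemma integral_inner_add_mul_inner_sub (h : IsAdditiveNoiseModel μ K Sig SigW σ X W ξ)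
    (hW : SigW.PosSemidef) (i : Fin n) {x : Vec p} (hx : ‖x‖ ≤ 1) (θ : Vec p) :
    ∫ ω, inner ℝ x (X i ω + W i ω) * (inner ℝ θ (W i ω) - ξ i ω) ∂μ =
      inner ℝ x (Matrix.toEuclideanLin SigW θ) := by
  rw [integral_mul_eq_covariance (h.subgaussian_inner_add hW i hx) (h.subgaussian_inner_sub hW i θ)]
  have hX := (h.subgaussian_inner_X i x).memLp_two
  have hWi := fun u =>
    (hasSubgaussianMGF_inner_multivariateGaussian hW (h.law_W i) u).memLp_two
  have hξ := (HasLaw.hasSubgaussianMGF_gaussianReal (h.law_ξ i)).memLp_two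
  have hind : IndepFun (fun ω => inner ℝ x (X i ω + W i ω)) (ξ i) μ :=
    (h.indep_XW_ξ i).comp (φ := fun z : Vec p × Vec p => inner ℝ x (z.1 + z.2)) (ψ := fun x => x)
      (by fun_prop) (by fun_prop)
  have hXW := (h.subgaussian_inner_add hW i hx).memLp_two
  have e1 := covariance_sub_right hXW (hWi θ) hξ
  rw [hind.covariance_eq_zero hXW hξ, sub_zero] at e1
  refine Eq.trans e1 ?_
  simp only [inner_add_right]
  have e2 := covariance_add_left hX (hWi x) (hWi θ)
  rw [h.covariance_inner_X_W hW, h.covariance_inner_W hW, zero_add] at e2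
  exact e2

end IsAdditiveNoiseModel

/-! ### Concentration of the corrected covariance and of the gradient -/

/-- The corrupted design matrix at an outcome. -/
def noisyDesign (X W : Fin n → Ω → Vec p) (ω : Ω) : Matrix (Fin n) (Fin p) ℝ :=
  Matrix.of fun i j => X i ω j + W i ω j

/-- The labels at an outcome. -/
noncomputable def labels (θbar : Vec p) (X : Fin n → Ω → Vec p) (ξ : Fin n → Ω → ℝ) (ω : Ω) :
    Fin n → ℝ := fun i => inner ℝ θbar (X i ω) + ξ i ω

omit [MeasurableSpace Ω] in
lemma noisyDesign_mulVec (X W : Fin n → Ω → Vec p) (ω : Ω) (y : Vec p) (i : Fin n) :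
    (noisyDesign X W ω).mulVec (WithLp.ofLp y) i = inner ℝ y (X i ω + W i ω) := by
  rw [inner_eq_sum]
  simp only [Matrix.mulVec, dotProduct, noisyDesign, Matrix.of_apply, PiLp.add_apply]
  exact Finset.sum_congr rfl fun j _ => mul_comm _ _

omit [MeasurableSpace Ω] in
lemma inner_GammaHat (SigW : Matrix (Fin p) (Fin p) ℝ) (X W : Fin n → Ω → Vec p) (ω : Ω)
    (x y : Vec p) :
    inner ℝ x (Matrix.toEuclideanLin (GammaHat SigW (noisyDesign X W ω)) y) =
      (n : ℝ)⁻¹ * ∑ i, inner ℝ x (X i ω + W i ω) * inner ℝ y (X i ω + W i ω) -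
        inner ℝ x (Matrix.toEuclideanLin SigW y) := by
  have e : ∀ A : Matrix (Fin p) (Fin p) ℝ, inner ℝ x (Matrix.toEuclideanLin A y) =
      WithLp.ofLp x ⬝ᵥ A.mulVec (WithLp.ofLp y) := fun A => inner_eq_dotProduct _ _
  rw [e, e, GammaHat, Matrix.sub_mulVec, dotProduct_sub, Matrix.smul_mulVec, dotProduct_smul,
    ← Matrix.mulVec_mulVec, Matrix.dotProduct_mulVec, Matrix.vecMul_transpose, smul_eq_mul]
  simp only [dotProduct, noisyDesign_mulVec]

omit [MeasurableSpace Ω] in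
-- The labels use the same `θ`, so the clean covariates cancel in `X̃ θ - Y`, leaving `⟨θ, W⟩ - ξ`.
lemma inner_lossGradient (SigW : Matrix (Fin p) (Fin p) ℝ) (X W : Fin n → Ω → Vec p)
    (ξ : Fin n → Ω → ℝ) (ω : Ω) (x θ : Vec p) :
    inner ℝ x (lossGradient SigW (noisyDesign X W ω) (labels θ X ξ ω) θ) =
      (n : ℝ)⁻¹ * ∑ i, inner ℝ x (X i ω + W i ω) * (inner ℝ θ (W i ω) - ξ i ω) -
        inner ℝ x (Matrix.toEuclideanLin SigW θ) := by
  rw [lossGradient, inner_sub_right, inner_GammaHat,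
    inner_eq_dotProduct x (WithLp.toLp 2 (gammaHat _ _)), gammaHat]
  rw [dotProduct_smul, smul_eq_mul, Matrix.dotProduct_mulVec, Matrix.vecMul_transpose]
  simp only [dotProduct, noisyDesign_mulVec, labels]
  rw [sub_right_comm, ← mul_sub, ← Finset.sum_sub_distrib]
  congr 2
  refine Finset.sum_congr rfl fun i _ => ?_
  rw [inner_add_right θ]
  ring

lemma IsAdditiveNoiseModel.measure_lt_abs_inner_GammaHat_sub_le
    (h : IsAdditiveNoiseModel μ K Sig SigW σ X W ξ) (hW : SigW.PosSemidef) (hn : 0 < n)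
    {x y : Vec p} (hx : ‖x‖ ≤ 1) (hy : ‖y‖ ≤ 1) {r : ℝ} (hr : 0 ≤ r) (hr' : r ≤ 48) :
    μ.real {ω | (K ^ 2 * opNorm Sig + opNorm SigW : ℝ) * r <
        |inner ℝ x (Matrix.toEuclideanLin (GammaHat SigW (noisyDesign X W ω)) y) -
          inner ℝ x (Matrix.toEuclideanLin Sig y)|} ≤ 2 * Real.exp (-(n * r ^ 2 / 768)) := by
  have hXm := h.measurable_X
  have hWm := h.measurable_W
  have hmeas : ∀ (u : Vec p) i, Measurable fun ω => (inner ℝ u (X i ω + W i ω) : ℝ) :=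
    fun u i => by fun_prop
  have hind : iIndepFun (fun i ω => (inner ℝ x (X i ω + W i ω) : ℝ) *
      inner ℝ y (X i ω + W i ω)) μ :=
    h.indep_samples.comp (fun _ z => (inner ℝ x (z.1 + z.2.1) : ℝ) * inner ℝ y (z.1 + z.2.1))
      fun _ => by fun_prop
  have h1 := measure_lt_abs_average_mul_sub_le hn (hmeas x) (hmeas y)
    (fun i => h.subgaussian_inner_add hW i hx) (fun i => h.subgaussian_inner_add hW i hy) hind
    (fun i => h.integral_inner_add_mul_inner_add hW i hx hy) hr hr'
  rw [Real.sqrt_mul_self (NNReal.coe_nonneg _)] at h1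
  push_cast at h1
  simp only [inner_GammaHat, sub_sub, add_comm (inner ℝ x (Matrix.toEuclideanLin SigW y))]
  exact h1

lemma IsAdditiveNoiseModel.measure_lt_abs_lossGradient_le
    (h : IsAdditiveNoiseModel μ K Sig SigW σ X W ξ) (hW : SigW.PosSemidef) (hn : 0 < n)
    (θ : Vec p) (j : Fin p) {r : ℝ} (hr : 0 ≤ r) (hr' : r ≤ 48) :
    μ.real {ω | √((K ^ 2 * opNorm Sig + opNorm SigW : ℝ) * (opNorm SigW * ‖θ‖ ^ 2 + σ ^ 2)) * r <
        |lossGradient SigW (noisyDesign X W ω) (labels θ X ξ ω) θ j|} ≤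
      2 * Real.exp (-(n * r ^ 2 / 768)) := by
  have hXm := h.measurable_X
  have hWm := h.measurable_W
  have hξm := h.measurable_ξ
  set x : Vec p := EuclideanSpace.single j 1
  have hx : ‖x‖ ≤ 1 := by simp [x]
  have hind : iIndepFun (fun i ω => (inner ℝ x (X i ω + W i ω) : ℝ) *
      (inner ℝ θ (W i ω) - ξ i ω)) μ :=
    h.indep_samples.comp (fun _ z => (inner ℝ x (z.1 + z.2.1) : ℝ) * (inner ℝ θ z.2.1 - z.2.2))
      fun _ => by fun_prop
  have h1 := measure_lt_abs_average_mul_sub_le hn (fun i => by fun_prop) (fun i => by fun_prop)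
    (fun i => h.subgaussian_inner_add hW i hx) (fun i => h.subgaussian_inner_sub hW i θ) hind
    (fun i => h.integral_inner_add_mul_inner_sub hW i hx θ) hr hr'
  push_cast at h1
  simp only [← inner_lossGradient SigW X W ξ] at h1
  simpa only [x, inner_single_one_left] using h1

end Model

section Nets

/-! ### Nets and restricted quadratic forms -/

/-- The unit ball of a `d`-dimensional space has a `1/2`-net of at most `5 ^ d` points. -/
lemma exists_half_net (E : Type*) [NormedAddCommGroup E] [NormedSpace ℝ E]
    [FiniteDimensional ℝ E] :
    ∃ N : Finset E, N.card ≤ 5 ^ Module.finrank ℝ E ∧ (∀ x ∈ N, ‖x‖ ≤ 1) ∧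
      ∀ x : E, ‖x‖ ≤ 1 → ∃ y ∈ N, ‖x - y‖ ≤ 1 / 2 := by
  classical
  -- A `1/2`-separated set of maximal size is a `1/2`-net: an uncovered point could be added.
  set P : ℕ → Prop := fun m => ∃ N : Finset E, N.card = m ∧ (∀ x ∈ N, ‖x‖ ≤ 1) ∧
    ∀ x ∈ N, ∀ y ∈ N, x ≠ y → 1 / 2 ≤ ‖x - y‖
  have hbound : ∀ m, P m → m ≤ 5 ^ Module.finrank ℝ E := by
    rintro m ⟨N, rfl, hN, hsep⟩
    -- Doubling gives a `1`-separated set in the ball of radius `2`, the setting of the Besicovitch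
    -- packing bound `5 ^ d`.
    have hinj : Function.Injective fun x : E => (2 : ℝ) • x := smul_right_injective E two_ne_zero
    rw [← Finset.card_image_of_injective N hinj]
    refine Besicovitch.card_le_of_separated _ ?_ ?_
    · simp only [Finset.mem_image, forall_exists_index, and_imp, forall_apply_eq_imp_iff₂]
      intro x hx
      rw [norm_smul]
      have := hN x hx
      norm_num
      linarith
    · simp only [Finset.mem_image, forall_exists_index, and_imp, forall_apply_eq_imp_iff₂]
      intro x hx y hy hxy
      rw [← smul_sub, norm_smul]
      have := hsep x hx y hy fun h => hxy (by rw [h])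
      norm_num
      linarith
  have h0 : P 0 := ⟨∅, by simp⟩
  have hmax := Nat.findGreatest_spec (P := P) (Nat.zero_le (5 ^ Module.finrank ℝ E)) h0
  obtain ⟨N, hcard, hN, hsep⟩ := hmax
  refine ⟨N, hcard ▸ Nat.findGreatest_le _, hN, fun x hx => ?_⟩
  by_contra! hcon
  have hxN : x ∉ N := fun h => by
    have := hcon x h
    norm_num at this
  have hP : P (N.card + 1) := by
    refine ⟨insert x N, Finset.card_insert_of_notMem hxN, ?_, ?_⟩
    · simpa [Finset.forall_mem_insert] using ⟨hx, hN⟩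
    · intro a ha b hb hab
      rcases Finset.mem_insert.1 ha with rfl | ha
      · rcases Finset.mem_insert.1 hb with rfl | hb
        · exact absurd rfl hab
        · exact (hcon b hb).le
      · rcases Finset.mem_insert.1 hb with hbx | hb
        · rw [hbx, norm_sub_rev]; exact (hcon a ha).le
        · exact hsep a ha b hb hab
  have := Nat.le_findGreatest (hbound _ hP) hP
  omega

/-- Each argument of the bilinear form costs a factor `2`: an error of `1/2` is absorbed via `‖w‖ ≤
δ + ‖w‖ / 2`, then via `‖T‖ ≤ 2 δ + ‖T‖ / 2`. -/
lemma opNorm_le_of_half_net {E : Type*} [NormedAddCommGroup E] [InnerProductSpace ℝ E]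
    {N : Finset E} (hN : ∀ x : E, ‖x‖ ≤ 1 → ∃ y ∈ N, ‖x - y‖ ≤ 1 / 2) {T : E →L[ℝ] E} {δ : ℝ}
    (hδ : 0 ≤ δ) (hT : ∀ x ∈ N, ∀ y ∈ N, |inner ℝ x (T y)| ≤ δ) : ‖T‖ ≤ 4 * δ := by
  have hvec : ∀ w : E, (∀ x ∈ N, |inner ℝ x w| ≤ δ) → ‖w‖ ≤ 2 * δ := by
    intro w hw
    rcases eq_or_ne w 0 with rfl | hw0
    · simpa using hδ
    have hw1 : ‖w‖ ≠ 0 := norm_ne_zero_iff.2 hw0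
    obtain ⟨y, hy, hxy⟩ := hN (‖w‖⁻¹ • w) (by rw [norm_smul]; simp [hw1])
    have h1 : inner ℝ (‖w‖⁻¹ • w) w = ‖w‖ := by
      rw [real_inner_smul_left, real_inner_self_eq_norm_sq]
      field_simp
    have h2 : inner ℝ (‖w‖⁻¹ • w - y) w ≤ 1 / 2 * ‖w‖ :=
      (real_inner_le_norm _ _).trans (mul_le_mul_of_nonneg_right hxy (norm_nonneg _))
    rw [inner_sub_left, h1] at h2
    linarith [(abs_le.1 (hw y hy)).2]
  have hball : ∀ x : E, ‖x‖ ≤ 1 → ‖T x‖ ≤ 2 * δ + 1 / 2 * ‖T‖ := by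
    intro x hx
    obtain ⟨y, hy, hxy⟩ := hN x hx
    have h1 := hvec (T y) fun z hz => hT z hz y hy
    have h2 : ‖T (x - y)‖ ≤ ‖T‖ * (1 / 2) := T.le_of_opNorm_le_of_le le_rfl hxy
    have h3 : T x = T y + T (x - y) := by rw [map_sub]; abel
    rw [h3]
    linarith [norm_add_le (T y) (T (x - y))]
  have := T.opNorm_le_of_unit_norm (C := 2 * δ + 1 / 2 * ‖T‖) (by positivity)
    fun x hx => hball x hx.le
  linarith

/-- A finite set of test vectors controls the quadratic forms on a subspace. -/
lemma exists_test_vectors {E : Type*} [NormedAddCommGroup E] [InnerProductSpace ℝ E]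
    [FiniteDimensional ℝ E] (F : Submodule ℝ E) {k : ℕ} (hk : Module.finrank ℝ F ≤ k) :
    ∃ N : Finset E, N.card ≤ 5 ^ k ∧ (∀ x ∈ N, ‖x‖ ≤ 1) ∧
      ∀ (T : E →L[ℝ] E) (δ : ℝ), 0 ≤ δ → (∀ x ∈ N, ∀ y ∈ N, |inner ℝ x (T y)| ≤ δ) →
        ∀ v ∈ F, |inner ℝ v (T v)| ≤ 4 * δ * ‖v‖ ^ 2 := by
  classical
  obtain ⟨N, hcard, hN, hnet⟩ := exists_half_net F
  refine ⟨N.image Subtype.val, Finset.card_image_le.trans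
    (hcard.trans (Nat.pow_le_pow_right (by norm_num) hk)), ?_, ?_⟩
  · intro x hx
    obtain ⟨y, hy, rfl⟩ := Finset.mem_image.1 hx
    exact hN y hy
  · intro T δ hδ hT v hv
    -- Compression of `T` to `F`, since the net sees only vectors of `F`.
    set A : F →L[ℝ] F := ContinuousLinearMap.adjoint F.subtypeL ∘L T ∘L F.subtypeL
    have hA : ∀ x y : F, inner ℝ x (A y) = inner ℝ (x : E) (T y) := fun x y => by
      simp only [A, ContinuousLinearMap.comp_apply]
      rw [ContinuousLinearMap.adjoint_inner_right]
      rfl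
    have h1 := opNorm_le_of_half_net hnet (T := A) hδ fun x hx y hy => by
      rw [hA]
      exact hT x (Finset.mem_image_of_mem _ hx) y (Finset.mem_image_of_mem _ hy)
    have h2 := abs_real_inner_le_norm (⟨v, hv⟩ : F) (A ⟨v, hv⟩)
    rw [hA] at h2
    have h3 := A.le_of_opNorm_le h1 ⟨v, hv⟩
    refine h2.trans ?_
    have h4 : ‖(⟨v, hv⟩ : F)‖ = ‖v‖ := rfl
    rw [h4] at h3 ⊢
    nlinarith [norm_nonneg v]

/-- Vectors supported in a set of coordinates. -/
def supportedIn {p : ℕ} (S : Finset (Fin p)) : Submodule ℝ (Vec p) where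
  carrier := {v | ∀ j ∉ S, v j = 0}
  add_mem' ha hb j hj := by simp [ha j hj, hb j hj]
  zero_mem' j _ := rfl
  smul_mem' c x hx j hj := by simp [hx j hj]

lemma finrank_supportedIn_le {p : ℕ} (S : Finset (Fin p)) :
    Module.finrank ℝ (supportedIn S) ≤ S.card := by
  let φ : supportedIn S →ₗ[ℝ] (S → ℝ) :=
    { toFun := fun v j => (v : Vec p) j
      map_add' := fun _ _ => rfl
      map_smul' := fun _ _ => rfl }
  have hφ : Function.Injective φ := by
    intro v w h
    ext j
    by_cases hj : j ∈ S
    · exact congrFun h ⟨j, hj⟩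
    · rw [v.2 j hj, w.2 j hj]
  simpa using LinearMap.finrank_le_finrank_of_injective hφ

/-- Test vectors for the quadratic form on all `k`-sparse vectors. -/
lemma exists_sparse_test_vectors {p k : ℕ} :
    ∃ N : (Fin k → Fin p) → Finset (Vec p), (∀ f, (N f).card ≤ 5 ^ k) ∧
      (∀ f, ∀ x ∈ N f, ‖x‖ ≤ 1) ∧
      ∀ (T : Vec p →L[ℝ] Vec p) (δ : ℝ), 0 ≤ δ →
        (∀ f, ∀ x ∈ N f, ∀ y ∈ N f, |inner ℝ x (T y)| ≤ δ) →
        ∀ v, l0 v ≤ k → |inner ℝ v (T v)| ≤ 4 * δ * ‖v‖ ^ 2 := by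
  have h := fun f : Fin k → Fin p => exists_test_vectors
    (supportedIn (Finset.univ.image f)) (k := k)
    ((finrank_supportedIn_le _).trans (Finset.card_image_le.trans (by simp)))
  choose N hcard hN hT using h
  refine ⟨N, hcard, hN, fun T δ hδ hbd v hv => ?_⟩
  set U := Finset.univ.filter fun i => v i ≠ 0
  have hU : U.card ≤ k := hv
  rcases U.eq_empty_or_nonempty with he | ⟨u, hu⟩
  · have : v = 0 := by
      ext j
      by_contra hj
      have : j ∈ U := by simpa [U] using hj
      simp [he] at this
    simp [this]
  -- Indexing supports by functions `Fin k → Fin p` makes their number exactly `p ^ k`; an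
  -- enumeration of a smaller support is padded with `u`.
  obtain ⟨f, hf⟩ : ∃ f : Fin k → Fin p, U ⊆ Finset.univ.image f := by
    let e := U.equivFin
    refine ⟨fun i => if h : (i : ℕ) < U.card then e.symm ⟨i, h⟩ else u, fun j hj => ?_⟩
    rw [Finset.mem_image]
    refine ⟨⟨e ⟨j, hj⟩, (e ⟨j, hj⟩).2.trans_le hU⟩, Finset.mem_univ _, ?_⟩
    simp
  refine hT f T δ hδ (hbd f) v fun j hj => ?_
  by_contra hne
  exact hj (hf (by simpa [U] using hne))

end Nets

/-! ### Union bounds over nets and over coordinates -/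

section Probability

variable {Ω : Type*} [MeasurableSpace Ω] {μ : Measure Ω} [IsProbabilityMeasure μ] {n p : ℕ}
  {K : ℝ≥0} {Sig SigW : Matrix (Fin p) (Fin p) ℝ} {σ : ℝ≥0} {X W : Fin n → Ω → Vec p}
  {ξ : Fin n → Ω → ℝ}

/-- Restricted concentration of the corrected covariance. -/
lemma IsAdditiveNoiseModel.measure_exists_sparse_le
    (h : IsAdditiveNoiseModel μ K Sig SigW σ X W ξ) (hW : SigW.PosSemidef) (hn : 0 < n)
    (k : ℕ) {r : ℝ} (hr : 0 ≤ r) (hr' : r ≤ 48) :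
    μ {ω | ∃ d, l0 d ≤ k ∧ 4 * ((K ^ 2 * opNorm Sig + opNorm SigW : ℝ) * r) * ‖d‖ ^ 2 <
        |inner ℝ (Matrix.toEuclideanLin (GammaHat SigW (noisyDesign X W ω)) d) d -
          inner ℝ (Matrix.toEuclideanLin Sig d) d|} ≤
      ENNReal.ofReal ((25 * p) ^ k * (2 * Real.exp (-(n * r ^ 2 / 768)))) := by
  obtain ⟨N, hcard, hN, hT⟩ := exists_sparse_test_vectors (p := p) (k := k)
  set δ := (K ^ 2 * opNorm Sig + opNorm SigW : ℝ) * r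
  have hδ : 0 ≤ δ := by positivity
  set bad : Vec p → Vec p → Set Ω := fun x y =>
    {ω | δ < |inner ℝ x (Matrix.toEuclideanLin (GammaHat SigW (noisyDesign X W ω)) y) -
          inner ℝ x (Matrix.toEuclideanLin Sig y)|}
  set q := 2 * Real.exp (-(n * r ^ 2 / 768))
  have hq : 0 ≤ q := by positivity
  have hbad : ∀ f, ∀ z ∈ N f ×ˢ N f, μ (bad z.1 z.2) ≤ ENNReal.ofReal q := by
    intro f z hz
    rw [Finset.mem_product] at hz
    rw [← ofReal_measureReal]
    exact ENNReal.ofReal_le_ofReal (h.measure_lt_abs_inner_GammaHat_sub_le hW hn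
      (hN f _ hz.1) (hN f _ hz.2) hr hr')
  have hsub : {ω | ∃ d, l0 d ≤ k ∧ 4 * δ * ‖d‖ ^ 2 <
        |inner ℝ (Matrix.toEuclideanLin (GammaHat SigW (noisyDesign X W ω)) d) d -
          inner ℝ (Matrix.toEuclideanLin Sig d) d|} ⊆
      ⋃ f ∈ (Finset.univ : Finset (Fin k → Fin p)), ⋃ z ∈ N f ×ˢ N f, bad z.1 z.2 := by
    rintro ω ⟨d, hd, hlt⟩
    by_contra hcon
    simp only [Set.mem_iUnion, Finset.mem_univ, exists_prop, true_and, not_exists, not_and,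
      Finset.mem_product, bad, Set.mem_ofPred_eq, not_lt] at hcon
    set T : Vec p →L[ℝ] Vec p :=
      Matrix.toEuclideanCLM (n := Fin p) (𝕜 := ℝ) (GammaHat SigW (noisyDesign X W ω)) -
        Matrix.toEuclideanCLM (n := Fin p) (𝕜 := ℝ) Sig
    have hTe : ∀ x y, inner ℝ x (T y) =
        inner ℝ x (Matrix.toEuclideanLin (GammaHat SigW (noisyDesign X W ω)) y) -
          inner ℝ x (Matrix.toEuclideanLin Sig y) := fun x y => inner_sub_right _ _ _
    have := hT T δ hδ (fun f x hx y hy => by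
      rw [hTe]
      exact hcon f (x, y) ⟨hx, hy⟩) d hd
    rw [hTe, real_inner_comm, real_inner_comm (Matrix.toEuclideanLin Sig d)] at this
    linarith
  refine (measure_mono hsub).trans ((measure_biUnion_finset_le _ _).trans ?_)
  -- At most `5^k · 5^k` pairs of net points per support; the `p ^ k` supports then give `(25 p) ^
  -- k`.
  have hf : ∀ f ∈ (Finset.univ : Finset (Fin k → Fin p)),
      μ (⋃ z ∈ N f ×ˢ N f, bad z.1 z.2) ≤ ENNReal.ofReal (25 ^ k * q) := by
    intro f _
    refine (measure_biUnion_finset_le _ _).trans ((Finset.sum_le_sum (hbad f)).trans ?_)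
    rw [Finset.sum_const, nsmul_eq_mul, Finset.card_product, ENNReal.ofReal_mul (p := 25 ^ k) (by positivity),
      ENNReal.ofReal_pow (p := 25) (by norm_num)]
    refine mul_le_mul_left ?_ _
    have : (N f).card * (N f).card ≤ 25 ^ k := by
      calc _ ≤ 5 ^ k * 5 ^ k := Nat.mul_le_mul (hcard f) (hcard f)
        _ = 25 ^ k := by rw [← mul_pow]; norm_num
    calc (((N f).card * (N f).card : ℕ) : ENNReal) ≤ ((25 ^ k : ℕ) : ENNReal) := by
          exact_mod_cast this
      _ = _ := by simp
  refine (Finset.sum_le_sum hf).trans (le_of_eq ?_)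
  rw [Finset.sum_const, nsmul_eq_mul]
  simp only [Finset.card_univ, Fintype.card_fun, Fintype.card_fin]
  rw [← ENNReal.ofReal_natCast, ← ENNReal.ofReal_mul (by positivity)]
  congr 1
  push_cast
  ring

/-- Uniform bound on the entries of the gradient at the true parameter. -/
lemma IsAdditiveNoiseModel.measure_exists_lossGradient_le
    (h : IsAdditiveNoiseModel μ K Sig SigW σ X W ξ) (hW : SigW.PosSemidef) (hn : 0 < n)
    (θ : Vec p) {r : ℝ} (hr : 0 ≤ r) (hr' : r ≤ 48) :
    μ {ω | ∃ j, √((K ^ 2 * opNorm Sig + opNorm SigW : ℝ) * (opNorm SigW * ‖θ‖ ^ 2 + σ ^ 2)) * r <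
        |lossGradient SigW (noisyDesign X W ω) (labels θ X ξ ω) θ j|} ≤
      ENNReal.ofReal (p * (2 * Real.exp (-(n * r ^ 2 / 768)))) := by
  rw [Set.ofPred_exists]
  refine (measure_iUnion_fintype_le _ _).trans ?_
  have hj : ∀ j ∈ Finset.univ, μ {ω | √((K ^ 2 * opNorm Sig + opNorm SigW : ℝ) *
      (opNorm SigW * ‖θ‖ ^ 2 + σ ^ 2)) * r <
        |lossGradient SigW (noisyDesign X W ω) (labels θ X ξ ω) θ j|} ≤
      ENNReal.ofReal (2 * Real.exp (-(n * r ^ 2 / 768))) := fun j _ => by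
    rw [← ofReal_measureReal]
    exact ENNReal.ofReal_le_ofReal (h.measure_lt_abs_lossGradient_le hW hn θ j hr hr')
  refine (Finset.sum_le_sum hj).trans (le_of_eq ?_)
  rw [Finset.sum_const, nsmul_eq_mul, ENNReal.ofReal_mul (p := (p : ℝ)) (by positivity)]
  simp

end Probability

section Main

/-! ### The guarantee holds with high probability -/

variable {Ω : Type*} [MeasurableSpace Ω] {μ : Measure Ω} [IsProbabilityMeasure μ] {n p : ℕ}
  {K : ℝ≥0} {Sig SigW : Matrix (Fin p) (Fin p) ℝ} {σ : ℝ≥0} {X W : Fin n → Ω → Vec p}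
  {ξ : Fin n → Ω → ℝ}

omit [MeasurableSpace Ω] in
lemma ihtGuarantee_sampleLoss (hp : 0 < p) (hSig : Sig.PosDef) (hW : SigW.PosSemidef)
    {sStar : ℕ} {θbar : Vec p} (hbar : l0 θbar ≤ sStar) {L M statErr : ℝ}
    (hL : 3 / 2 * sigmaMax Sig ≤ L) (hL' : L ≤ 7 / 4 * sigmaMax Sig) {ω : Ω}
    (hrsc : ∀ d, l0 d ≤ rscLevel Sig sStar →
      |inner ℝ (Matrix.toEuclideanLin (GammaHat SigW (noisyDesign X W ω)) d) d -
        inner ℝ (Matrix.toEuclideanLin Sig d) d| ≤ sigmaMin Sig / 2 * ‖d‖ ^ 2)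
    (hM : ∀ j, |lossGradient SigW (noisyDesign X W ω) (labels θbar X ξ ω) θbar j| ≤ M)
    (herr : 160 * (kappa Sig / sigmaMin Sig) * √sStar * M ≤ statErr) :
    IHTGuarantee Sig sStar θbar (sampleLoss SigW θbar X W ξ ω) (2 / (3 * L)) statErr 20 := by
  refine ihtGuarantee_of_restricted hp hSig hbar (M := M)
    (Q := fun d => inner ℝ (Matrix.toEuclideanLin (GammaHat SigW (noisyDesign X W ω)) d) d)
    (continuous_correctedLoss _ _ _) (fun θ d => ?_) hL hL' (fun d hd => ?_) (fun d hd => ?_)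
    (fun j => ?_) herr
  · exact (correctedLoss_add hW _ _ θ d).trans (by rw [← gradient_correctedLoss hW]; rfl)
  · have h1 := (abs_le.1 (hrsc d hd)).1
    have h2 := sigmaMin_mul_norm_sq_le hSig.posSemidef d
    linarith
  · have h1 := (abs_le.1 (hrsc d hd)).2
    have h2 := inner_toEuclideanLin_le (A := Sig) d
    have h3 := mul_le_mul_of_nonneg_right (sigmaMin_le_sigmaMax (A := Sig)) (sq_nonneg ‖d‖)
    linarith
  · have := hM j
    rw [← gradient_correctedLoss hW] at this
    exact this

/-- As `25 ≤ 2⁵ ≤ p⁵`, the count is at most `p ^ (6k)`, so the exponent `7 k log p` leaves a factor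
`p ^ (-k) ≤ 1 / p`. -/
lemma exp_union_bound {p k : ℕ} (hp : 2 ≤ p) (hk : 0 < k) {e : ℝ} (he : 7 * k * Real.log p ≤ e) :
    (25 * p : ℝ) ^ k * (2 * Real.exp (-e)) ≤ 2 / p := by
  have hp2 : (2 : ℝ) ≤ p := by exact_mod_cast hp
  have hp0 : (0 : ℝ) < p := by linarith
  have h1 : (25 * p : ℝ) ≤ p ^ 6 := by
    have : (2 : ℝ) ^ 5 ≤ (p : ℝ) ^ 5 := pow_le_pow_left₀ (by norm_num) hp2 5
    have e6 : (p : ℝ) ^ 6 = p ^ 5 * p := by ring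
    rw [e6]
    exact mul_le_mul_of_nonneg_right (by linarith) hp0.le
  have h2 : Real.exp (-e) ≤ ((p : ℝ) ^ (7 * k))⁻¹ := by
    have e2 : (p : ℝ) ^ (7 * k) = Real.exp (7 * k * Real.log p) := by
      rw [← Real.exp_log (pow_pos hp0 _), Real.log_pow]
      push_cast
      ring_nf
    rw [e2, ← Real.exp_neg]
    exact Real.exp_le_exp.2 (by linarith)
  calc (25 * p : ℝ) ^ k * (2 * Real.exp (-e))
      ≤ ((p : ℝ) ^ 6) ^ k * (2 * ((p : ℝ) ^ (7 * k))⁻¹) := by gcongr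
    _ = 2 * ((p : ℝ) ^ k)⁻¹ := by
        rw [← pow_mul, show 7 * k = 6 * k + k by ring, pow_add]
        field_simp
    _ ≤ 2 * ((p : ℝ) ^ 1)⁻¹ := by
        have : (p : ℝ) ^ 1 ≤ p ^ k := pow_le_pow_right₀ (by linarith) hk
        gcongr
    _ = 2 / p := by rw [pow_one]; rfl

/-- The subgaussian proxy of the corrupted covariates in terms of their scale. -/
lemma proxy_le (K : ℝ≥0) (a b : ℝ≥0) :
    (K ^ 2 * a + b : ℝ) ≤ max ((K : ℝ) ^ 2) 1 * (a + b) := by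
  have h1 := mul_le_mul_of_nonneg_right (le_max_left ((K : ℝ) ^ 2) 1) a.coe_nonneg
  have h2 := mul_le_mul_of_nonneg_right (le_max_right ((K : ℝ) ^ 2) 1) b.coe_nonneg
  linarith

/-- Common core of both parts of the theorem: the step size enters only through the window for `L`,
and the scale `v` only through the lower bound on `n`. -/
lemma IsAdditiveNoiseModel.measure_not_ihtGuarantee_le
    (h : IsAdditiveNoiseModel μ K Sig SigW σ X W ξ) (hp : 0 < p) (hSig : Sig.PosDef)
    (hW : SigW.PosSemidef) {sStar : ℕ} {θbar : Vec p} (hbar : l0 θbar ≤ sStar) {L statErr : ℝ}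
    (hn : 344064 * max ((K : ℝ) ^ 2) 1 ^ 2 * rscLevel Sig sStar *
      max (((opNorm Sig : ℝ) + opNorm SigW) ^ 2 / sigmaMin Sig ^ 2) 1 * Real.log p ≤ n)
    (hL : 3 / 2 * sigmaMax Sig ≤ L) (hL' : L ≤ 7 / 4 * sigmaMax Sig)
    (herr : 6400 * √(max ((K : ℝ) ^ 2) 1) * (kappa Sig / sigmaMin Sig) *
      (√((opNorm SigW : ℝ) + opNorm Sig) * (√(opNorm SigW : ℝ) * ‖θbar‖ + σ)) *
        √((sStar : ℝ) * Real.log p / n) ≤ statErr) :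
    μ {ω | ¬ IHTGuarantee Sig sStar θbar (sampleLoss SigW θbar X W ξ ω) (2 / (3 * L)) statErr 20}
      ≤ ENNReal.ofReal (4 / p) := by
  set K₁ := max ((K : ℝ) ^ 2) 1
  have hK₁ : 1 ≤ K₁ := le_max_right _ _
  set v := (opNorm Sig : ℝ) + opNorm SigW
  set s₀ := sigmaMin Sig
  have hs₀ : 0 < s₀ := sigmaMin_pos hp hSig
  have hsv : s₀ ≤ v := (sigmaMin_le_opNorm hp).trans (le_add_of_nonneg_right (NNReal.coe_nonneg _))
  have hv : 0 < v := hs₀.trans_le hsv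
  have hmax1 : 1 ≤ max (v ^ 2 / s₀ ^ 2) 1 := le_max_right _ _
  -- For `p = 1` the logarithm vanishes, but the claimed bound `4 / p` exceeds `1`.
  rcases Nat.lt_or_ge p 2 with hp1 | hp2
  · obtain rfl : p = 1 := by omega
    refine prob_le_one.trans ?_
    rw [← ENNReal.ofReal_one]
    exact ENNReal.ofReal_le_ofReal (by norm_num)
  -- Here `k = 0`, so `n = 0` is possible and concentration is unavailable; but only `d = 0` is
  -- tested, and the factor `√s* = 0` allows any gradient bound `M`.
  rcases Nat.eq_zero_or_pos sStar with rfl | hs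
  · have hk0 : rscLevel Sig 0 = 0 := by simp [rscLevel, iterSparsity]
    have : ∀ ω, IHTGuarantee Sig 0 θbar (sampleLoss SigW θbar X W ξ ω) (2 / (3 * L)) statErr 20 := by
      intro ω
      refine ihtGuarantee_sampleLoss hp hSig hW hbar hL hL' (fun d hd => ?_)
        (M := ∑ j, |lossGradient SigW (noisyDesign X W ω) (labels θbar X ξ ω) θbar j|)
        (fun j => Finset.single_le_sum
          (f := fun j => |lossGradient SigW (noisyDesign X W ω) (labels θbar X ξ ω) θbar j|)
          (fun _ _ => abs_nonneg _) (Finset.mem_univ j)) ?_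
      · rw [hk0] at hd
        have hd0 : d = 0 := by
          have : hammingNorm (WithLp.ofLp d) = 0 := Nat.le_zero.1 hd
          rw [hammingNorm_eq_zero] at this
          ext j
          exact congrFun this j
        simp [hd0]
      · simpa using herr
    simp [this]
  set k := rscLevel Sig sStar
  have hk : 0 < k := by simp only [k, rscLevel]; omega
  have hk1 : (1 : ℝ) ≤ k := by exact_mod_cast hk
  have hpR : (2 : ℝ) ≤ p := by exact_mod_cast hp2
  have hp0 : (0 : ℝ) < p := by linarith
  have hlog : 0 < Real.log p := Real.log_pos (by linarith)
  have hA : 1 ≤ K₁ ^ 2 := one_le_pow₀ hK₁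
  have hnlog : 344064 * Real.log p ≤ n := by
    refine le_trans ?_ hn
    have : 1 ≤ K₁ ^ 2 * k * max (v ^ 2 / s₀ ^ 2) 1 :=
      one_le_mul_of_one_le_of_one_le (one_le_mul_of_one_le_of_one_le hA hk1) hmax1
    nlinarith
  have hn0 : (0 : ℝ) < n := by linarith
  have hnpos : 0 < n := by exact_mod_cast hn0
  set C := (K ^ 2 * opNorm Sig + opNorm SigW : ℝ)
  have hC0 : 0 ≤ C := by positivity
  have hC : C ≤ K₁ * v := proxy_le K _ _
  -- Chosen so that `4 C r₁ ≤ s₀ / 2`. The exponent `n r₁² / 768` reaches `7 k log p` because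
  -- `344064 = 7 · 768 · 64`.
  set r₁ := s₀ / (8 * (K₁ * v))
  have hKv : 0 < K₁ * v := by positivity
  have hr₁ : r₁ ≤ 48 := by
    rw [div_le_iff₀ (by positivity)]
    nlinarith
  have hE₁ := h.measure_exists_sparse_le hW hnpos k (r := r₁) (by positivity) hr₁
  have hexp₁ : 7 * k * Real.log p ≤ n * r₁ ^ 2 / 768 := by
    have h1 : 344064 * K₁ ^ 2 * k * (v ^ 2 / s₀ ^ 2) * Real.log p ≤ n := by
      refine le_trans ?_ hn
      gcongr
      exact le_max_left _ _
    have h2 : n * r₁ ^ 2 / 768 = n * (s₀ ^ 2 / (49152 * (K₁ ^ 2 * v ^ 2))) := by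
      simp only [r₁]
      field_simp
      norm_num
    have h3 := mul_le_mul_of_nonneg_right h1
      (by positivity : 0 ≤ s₀ ^ 2 / (49152 * (K₁ ^ 2 * v ^ 2)))
    have h4 : 344064 * K₁ ^ 2 * k * (v ^ 2 / s₀ ^ 2) * Real.log p *
        (s₀ ^ 2 / (49152 * (K₁ ^ 2 * v ^ 2))) = 7 * k * Real.log p := by
      field_simp
      norm_num
    rw [h2]
    linarith
  -- Makes the Bernstein exponent `2 log p`, so that `p` coordinates cost `2 / p`; as `√1536 ≤ 40`,
  -- the error constant is `160 · 40 = 6400`.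
  set r₂ := √(1536 * Real.log p / n)
  have hr₂sq : r₂ ^ 2 = 1536 * Real.log p / n := Real.sq_sqrt (by positivity)
  have hr₂ : r₂ ≤ 48 := by
    refine Real.sqrt_le_iff.2 ⟨by norm_num, ?_⟩
    rw [div_le_iff₀ hn0]
    linarith
  have hE₂ := h.measure_exists_lossGradient_le hW hnpos θbar (r := r₂) (Real.sqrt_nonneg _) hr₂
  have hexp₂ : (p : ℝ) * (2 * Real.exp (-(n * r₂ ^ 2 / 768))) ≤ 2 / p := by
    have h1 : n * r₂ ^ 2 / 768 = Real.log p + Real.log p := by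
      rw [hr₂sq]
      field_simp
      norm_num
    rw [h1, neg_add, Real.exp_add, Real.exp_neg, Real.exp_log hp0]
    apply le_of_eq
    field_simp
  set M := √(C * (opNorm SigW * ‖θbar‖ ^ 2 + σ ^ 2)) * r₂
  -- Only this inclusion is needed; measurability of the failure event plays no role.
  have hsub : {ω | ¬ IHTGuarantee Sig sStar θbar (sampleLoss SigW θbar X W ξ ω) (2 / (3 * L))
      statErr 20} ⊆
      {ω | ∃ d, l0 d ≤ k ∧ 4 * (C * r₁) * ‖d‖ ^ 2 <
        |inner ℝ (Matrix.toEuclideanLin (GammaHat SigW (noisyDesign X W ω)) d) d -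
          inner ℝ (Matrix.toEuclideanLin Sig d) d|} ∪
      {ω | ∃ j, M < |lossGradient SigW (noisyDesign X W ω) (labels θbar X ξ ω) θbar j|} := by
    intro ω hω
    by_contra hcon
    simp only [Set.mem_union, Set.mem_ofPred_eq, not_or, not_exists, not_and, not_lt] at hcon
    refine hω (ihtGuarantee_sampleLoss hp hSig hW hbar hL hL' (fun d hd => ?_) hcon.2 ?_)
    · refine (hcon.1 d hd).trans (mul_le_mul_of_nonneg_right ?_ (sq_nonneg _))
      have h1 : C * r₁ ≤ K₁ * v * r₁ := mul_le_mul_of_nonneg_right hC (by positivity)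
      have h2 : K₁ * v * r₁ = s₀ / 8 := by
        simp only [r₁]
        field_simp
      linarith
    · refine le_trans ?_ herr
      set q := √(opNorm SigW : ℝ) * ‖θbar‖ + σ
      have hq0 : 0 ≤ q := by positivity
      have hq : opNorm SigW * ‖θbar‖ ^ 2 + (σ : ℝ) ^ 2 ≤ q ^ 2 := by
        have h1 : √(opNorm SigW : ℝ) ^ 2 = opNorm SigW := Real.sq_sqrt (NNReal.coe_nonneg _)
        have h2 : 0 ≤ √(opNorm SigW : ℝ) * ‖θbar‖ * σ := by positivity
        have h3 : q ^ 2 = √(opNorm SigW : ℝ) ^ 2 * ‖θbar‖ ^ 2 + (σ : ℝ) ^ 2 +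
            2 * (√(opNorm SigW : ℝ) * ‖θbar‖ * σ) := by simp only [q]; ring
        rw [h3, h1]
        linarith
      have hroot : √(C * (opNorm SigW * ‖θbar‖ ^ 2 + σ ^ 2)) ≤ √K₁ * √v * q := by
        refine Real.sqrt_le_iff.2 ⟨by positivity, ?_⟩
        rw [mul_pow, mul_pow, Real.sq_sqrt (by positivity), Real.sq_sqrt hv.le]
        gcongr
      have hr₂' : √(sStar : ℝ) * r₂ ≤ 40 * √((sStar : ℝ) * Real.log p / n) := by
        have h40 : (40 : ℝ) = √(1600) := by
          rw [show (1600 : ℝ) = 40 ^ 2 by norm_num, Real.sqrt_sq (by norm_num)]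
        rw [h40, ← Real.sqrt_mul (Nat.cast_nonneg _), ← Real.sqrt_mul (by norm_num)]
        refine Real.sqrt_le_sqrt ?_
        have : 0 ≤ (sStar : ℝ) * Real.log p / n := by positivity
        calc (sStar : ℝ) * (1536 * Real.log p / n) = 1536 * (sStar * Real.log p / n) := by ring
          _ ≤ _ := by linarith
      have hκ : 0 ≤ kappa Sig / s₀ := div_nonneg (by linarith [one_le_kappa hp hSig]) hs₀.le
      rw [add_comm (opNorm SigW : ℝ)]
      calc 160 * (kappa Sig / s₀) * √sStar * M
          = 160 * (kappa Sig / s₀) * √(C * (opNorm SigW * ‖θbar‖ ^ 2 + σ ^ 2)) *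
            (√sStar * r₂) := by simp only [M]; ring
        _ ≤ 160 * (kappa Sig / s₀) * (√K₁ * √v * q) *
            (40 * √((sStar : ℝ) * Real.log p / n)) := by gcongr
        _ = _ := by simp only [v]; ring
  refine (measure_mono hsub).trans ((measure_union_le _ _).trans
    ((add_le_add hE₁ hE₂).trans ?_))
  rw [← ENNReal.ofReal_add (by positivity) (by positivity)]
  refine ENNReal.ofReal_le_ofReal ?_
  have h1 := exp_union_bound hp2 hk hexp₁
  have h2 : (4 : ℝ) / p = 2 / p + 2 / p := by ring
  linarith

lemma four_mul_rscLevel_mul_tol (hp : 0 < p) (hSig : Sig.PosDef) (c₀ v : ℝ) (sStar : ℕ) :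
    4 * (rscLevel Sig sStar : ℝ) * tol c₀ v Sig / sigmaMin Sig =
      4 * c₀ * rscLevel Sig sStar * max (v ^ 2 / sigmaMin Sig ^ 2) 1 * Real.log p := by
  have := (sigmaMin_pos hp hSig).ne'
  rw [tol]
  field_simp

/-- The sample size condition says `k τ(p) / n ≤ σ_min / 4`, hence `7/4 = 3/2 + 1/4`. -/
lemma smoothness_bounds (hp : 0 < p) (hSig : Sig.PosDef) {c₀ v : ℝ} (hc₀ : 0 ≤ c₀) {sStar : ℕ}
    (hn : 4 * (rscLevel Sig sStar : ℝ) * tol c₀ v Sig / sigmaMin Sig ≤ n) :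
    3 / 2 * sigmaMax Sig ≤ smoothness c₀ v Sig sStar n ∧
      smoothness c₀ v Sig sStar n ≤ 7 / 4 * sigmaMax Sig := by
  have hmin := sigmaMin_pos hp hSig
  have hlog : 0 ≤ Real.log p := Real.log_natCast_nonneg p
  have htol : 0 ≤ tol c₀ v Sig := by
    rw [tol]
    have : 0 ≤ max (v ^ 2 / sigmaMin Sig ^ 2) 1 := zero_le_one.trans (le_max_right _ _)
    positivity
  have h0 : 0 ≤ rscLevel Sig sStar * tol c₀ v Sig / n := by positivity
  have h1 : rscLevel Sig sStar * tol c₀ v Sig / n ≤ sigmaMin Sig / 4 := by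
    refine div_le_of_le_mul₀ (Nat.cast_nonneg _) (by positivity) ?_
    rw [div_le_iff₀ hmin] at hn
    linarith
  rw [smoothness]
  constructor
  · linarith
  · linarith [sigmaMin_le_sigmaMax (A := Sig)]

/-- `m (a + b) ≤ (a + b)² ≤ 2 (a² + b²)`: the lower bound `m` trades the linear scale for the
quadratic one. -/
lemma add_le_two_div_mul_sq_add_sq {m a b : ℝ} (hm : 0 < m) (hab : m ≤ a + b) :
    a + b ≤ 2 / m * (a ^ 2 + b ^ 2) := by
  rw [div_mul_eq_mul_div, le_div_iff₀ hm]
  nlinarith [sq_nonneg (a - b)]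

/-- Comparison of the two noise levels when all scales are bounded below. -/
lemma noiseLevel_le {m a b t s : ℝ} (hm : 0 < m) (hb : 0 ≤ b) (hs : 0 ≤ s)
    (hab : m ≤ a + b) (hbs : m ≤ b + s) (ht : m ≤ t) :
    √(b + a) * (√b * t + s) ≤
      √(2 / m) * (1 / √m + 1 / m) * (√(b ^ 2 + a ^ 2) * (b + s) * t) := by
  have ht0 : 0 < t := hm.trans_le ht
  have h1 : √(b + a) ≤ √(2 / m) * √(b ^ 2 + a ^ 2) := by
    rw [← Real.sqrt_mul (by positivity)]
    refine Real.sqrt_le_sqrt ?_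
    have := add_le_two_div_mul_sq_add_sq hm hab
    rw [add_comm b, add_comm (b ^ 2)]
    exact this
  have hsm : 0 < √m := Real.sqrt_pos.2 hm
  have h2 : √b ≤ 1 / √m * (b + s) := by
    rw [div_mul_eq_mul_div, one_mul, le_div_iff₀ hsm]
    have e1 : √b ≤ √(b + s) := Real.sqrt_le_sqrt (by linarith)
    have e2 : √m ≤ √(b + s) := Real.sqrt_le_sqrt hbs
    calc √b * √m ≤ √(b + s) * √(b + s) := by gcongr
      _ = b + s := Real.mul_self_sqrt (by linarith)
  have h3 : s ≤ 1 / m * (b + s) * t := by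
    have e1 : 1 / m * (b + s) * t = (b + s) * (t / m) := by ring
    rw [e1]
    have e2 : 1 ≤ t / m := (one_le_div hm).2 ht
    nlinarith
  have h4 : √b * t + s ≤ (1 / √m + 1 / m) * ((b + s) * t) := by
    have := mul_le_mul_of_nonneg_right h2 ht0.le
    linarith
  calc √(b + a) * (√b * t + s)
      ≤ (√(2 / m) * √(b ^ 2 + a ^ 2)) * ((1 / √m + 1 / m) * ((b + s) * t)) := by
        gcongr
    _ = _ := by ring

end Main

end NoisyIHT

theorem mainTheorem7 (K : ℝ≥0) :
    -- scale-invariant form: the constants depend only on `K`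
    (∃ c₀ c₁ c₂ c₃ c₄ : ℝ, 0 < c₀ ∧ 0 < c₁ ∧ 0 < c₂ ∧ 0 < c₃ ∧ 0 < c₄ ∧
      ∀ (n p sStar : ℕ), 0 < p →
      ∀ (Sig SigW : Matrix (Fin p) (Fin p) ℝ), Sig.PosDef → SigW.PosSemidef →
      ∀ (σ : ℝ≥0) (θbar : NoisyIHT.Vec p), NoisyIHT.l0 θbar ≤ sStar →
      ∀ (Ω : Type*) [MeasurableSpace Ω] (μ : Measure Ω) [IsProbabilityMeasure μ]
        (X W : Fin n → Ω → NoisyIHT.Vec p) (ξ : Fin n → Ω → ℝ),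
        NoisyIHT.IsAdditiveNoiseModel μ K Sig SigW σ X W ξ →
      ∀ v σtil : ℝ,
        v = (NoisyIHT.opNorm Sig : ℝ) + NoisyIHT.opNorm SigW →
        σtil = √((NoisyIHT.opNorm SigW : ℝ) + NoisyIHT.opNorm Sig) *
          (√(NoisyIHT.opNorm SigW : ℝ) * ‖θbar‖ + σ) →
        4 * (NoisyIHT.rscLevel Sig sStar : ℝ) * NoisyIHT.tol c₀ v Sig /
          NoisyIHT.sigmaMin Sig ≤ n →
        μ {ω | ¬ NoisyIHT.IHTGuarantee Sig sStar θbar (NoisyIHT.sampleLoss SigW θbar X W ξ ω)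
            (NoisyIHT.stepSize c₀ v Sig sStar n)
            (c₃ * (NoisyIHT.kappa Sig / NoisyIHT.sigmaMin Sig) * σtil *
              √((sStar : ℝ) * Real.log p / n)) c₄}
          ≤ ENNReal.ofReal (c₁ * (p : ℝ) ^ (-c₂))) ∧
    -- form with `σ̃ ‖θbar‖`: the constants depend only on `K` and on a lower bound `m` for the
    -- design, noise and signal scales
    (∀ m : ℝ, 0 < m →
     ∃ c₀ c₁ c₂ c₃ c₄ : ℝ, 0 < c₀ ∧ 0 < c₁ ∧ 0 < c₂ ∧ 0 < c₃ ∧ 0 < c₄ ∧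
      ∀ (n p sStar : ℕ), 0 < p →
      ∀ (Sig SigW : Matrix (Fin p) (Fin p) ℝ), Sig.PosDef → SigW.PosSemidef →
      ∀ (σ : ℝ≥0) (θbar : NoisyIHT.Vec p), NoisyIHT.l0 θbar ≤ sStar →
        m ≤ (NoisyIHT.opNorm Sig : ℝ) + NoisyIHT.opNorm SigW →
        m ≤ (NoisyIHT.opNorm SigW : ℝ) + σ →
        m ≤ ‖θbar‖ →
      ∀ (Ω : Type*) [MeasurableSpace Ω] (μ : Measure Ω) [IsProbabilityMeasure μ]
        (X W : Fin n → Ω → NoisyIHT.Vec p) (ξ : Fin n → Ω → ℝ),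
        NoisyIHT.IsAdditiveNoiseModel μ K Sig SigW σ X W ξ →
      ∀ v σtil : ℝ,
        v = (NoisyIHT.opNorm Sig : ℝ) ^ 2 + (NoisyIHT.opNorm SigW : ℝ) ^ 2 →
        σtil = √((NoisyIHT.opNorm SigW : ℝ) ^ 2 + (NoisyIHT.opNorm Sig : ℝ) ^ 2) *
          (NoisyIHT.opNorm SigW + σ) →
        4 * (NoisyIHT.rscLevel Sig sStar : ℝ) * NoisyIHT.tol c₀ v Sig /
          NoisyIHT.sigmaMin Sig ≤ n →
        μ {ω | ¬ NoisyIHT.IHTGuarantee Sig sStar θbar (NoisyIHT.sampleLoss SigW θbar X W ξ ω)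
            (NoisyIHT.stepSize c₀ v Sig sStar n)
            (c₃ * (NoisyIHT.kappa Sig / NoisyIHT.sigmaMin Sig) * σtil * ‖θbar‖ *
              √((sStar : ℝ) * Real.log p / n)) c₄}
          ≤ ENNReal.ofReal (c₁ * (p : ℝ) ^ (-c₂))) := by
  refine ⟨?_, fun m hm => ?_⟩
  -- `86016 = 344064 / 4`, because the sample size condition already carries a factor `4`.
  · refine ⟨86016 * max ((K : ℝ) ^ 2) 1 ^ 2, 4, 1, 6400 * √(max ((K : ℝ) ^ 2) 1), 20,
      by positivity, by norm_num, by norm_num, by positivity, by norm_num, ?_⟩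
    intro n p sStar hp Sig SigW hSig hW σ θbar hbar Ω _ μ _ X W ξ h v σtil hv hσtil hn
    obtain ⟨hL, hL'⟩ := NoisyIHT.smoothness_bounds hp hSig (by positivity) hn
    rw [NoisyIHT.four_mul_rscLevel_mul_tol hp hSig, hv] at hn
    refine (h.measure_not_ihtGuarantee_le hp hSig hW hbar ?_ hL hL' ?_).trans (le_of_eq ?_)
    · refine le_trans (le_of_eq ?_) hn
      ring
    · rw [hσtil]
    · rw [Real.rpow_neg_one]
      rfl
  · set K₁ := max ((K : ℝ) ^ 2) 1
    have hK₁ : 0 < K₁ := zero_lt_one.trans_le (le_max_right _ _)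
    have hB : 1 ≤ max ((2 / m) ^ 2) 1 := le_max_right _ _
    have hsm : 0 < √m := Real.sqrt_pos.2 hm
    -- The linear scale is at most `2 / m` times the quadratic one and enters squared; the extra
    -- factor in `c₃` is the one from `noiseLevel_le`.
    refine ⟨86016 * K₁ ^ 2 * max ((2 / m) ^ 2) 1, 4, 1,
      6400 * √K₁ * (√(2 / m) * (1 / √m + 1 / m)), 20, by positivity, by norm_num, by norm_num,
      by positivity, by norm_num, ?_⟩
    intro n p sStar hp Sig SigW hSig hW σ θbar hbar hm₁ hm₂ hm₃ Ω _ μ _ X W ξ h v σtil hv hσtil hn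
    obtain ⟨hL, hL'⟩ := NoisyIHT.smoothness_bounds hp hSig (by positivity) hn
    rw [NoisyIHT.four_mul_rscLevel_mul_tol hp hSig] at hn
    have hlog : 0 ≤ Real.log p := Real.log_natCast_nonneg p
    have hs₀ := NoisyIHT.sigmaMin_pos hp hSig
    refine (h.measure_not_ihtGuarantee_le hp hSig hW hbar ?_ hL hL' ?_).trans (le_of_eq ?_)
    · have hle : max (((NoisyIHT.opNorm Sig : ℝ) + NoisyIHT.opNorm SigW) ^ 2 /
          NoisyIHT.sigmaMin Sig ^ 2) 1 ≤
          max ((2 / m) ^ 2) 1 * max (v ^ 2 / NoisyIHT.sigmaMin Sig ^ 2) 1 := by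
        refine max_le ?_ (one_le_mul_of_one_le_of_one_le hB (le_max_right _ _))
        have h1 : ((NoisyIHT.opNorm Sig : ℝ) + NoisyIHT.opNorm SigW) ^ 2 ≤
            (2 / m) ^ 2 * v ^ 2 := by
          rw [← mul_pow, hv]
          exact pow_le_pow_left₀ (by positivity)
            (NoisyIHT.add_le_two_div_mul_sq_add_sq hm hm₁) 2
        calc _ ≤ (2 / m) ^ 2 * v ^ 2 / NoisyIHT.sigmaMin Sig ^ 2 := by gcongr
          _ = (2 / m) ^ 2 * (v ^ 2 / NoisyIHT.sigmaMin Sig ^ 2) := by ring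
          _ ≤ _ := mul_le_mul (le_max_left _ _) (le_max_left _ _) (by positivity)
            (by positivity)
      refine le_trans ?_ hn
      calc _ ≤ 344064 * K₁ ^ 2 * NoisyIHT.rscLevel Sig sStar * (max ((2 / m) ^ 2) 1 *
            max (v ^ 2 / NoisyIHT.sigmaMin Sig ^ 2) 1) * Real.log p := by gcongr
        _ = _ := by ring
    · have hρ := NoisyIHT.noiseLevel_le hm (NNReal.coe_nonneg (NoisyIHT.opNorm SigW))
        (NNReal.coe_nonneg σ) hm₁ hm₂ hm₃
      rw [← hσtil] at hρ
      have hκ : 0 ≤ NoisyIHT.kappa Sig / NoisyIHT.sigmaMin Sig :=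
        div_nonneg (by linarith [NoisyIHT.one_le_kappa hp hSig]) hs₀.le
      calc _ ≤ 6400 * √K₁ * (NoisyIHT.kappa Sig / NoisyIHT.sigmaMin Sig) *
            (√(2 / m) * (1 / √m + 1 / m) * (σtil * ‖θbar‖)) *
              √((sStar : ℝ) * Real.log p / n) := by gcongr
        _ = _ := by ring
    · rw [Real.rpow_neg_one]
      rfl
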